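/- **Setting.** A *star-autonomous category* is a monoidal category $(\mathcal C,\otimes,I)$ (neither strict nor symmetric in general; associativity isomorphisms $\alpha$ are written where they matter) with an adjoint equivalence $S\dashv S':\mathcal C^{\mathrm{op}}\to\mathcal C$ and bijections $\tau:\mathcal C(A\otimes B,SD)\cong\mathcal C(A,S(B\otimes D))$, natural in $A,B,D$ and compatible with associativity: for $f:(A\otimes B)\otimes D\to SF$, the morphisms $\tau(\tau f)$ and $S(\alpha^{-1}_{B,D,F})\circ\tau(f\alpha^{-1}_{A,B,D})$ from $A$ to $S(B\otimes(D\otimes F))$ agree. Let $e_{A,B}:S(A\otimes B)\otimes A\to SB$ be the morphism with $\tau(e_{A,B})=1$, and $e'_{B,A}:B\otimes S'(A\otimes B)\to S'A$ the transpose under $S\dashv S'$ of the image under $\tau$ of $A\otimes B\cong SS'(A\otimes B)$. Such a $\mathcal C$ is a linearly distributive category with negations as follows: $\star=\otimes$, $A\diamond B=S'(SB\otimes SA)\cong S(S'B\otimes S'A)$ and $J=SI\cong S'I$; the distribution $\partial_l:A\otimes(B\diamond D)\to(A\otimes B)\diamond D$ is $$A\otimes S'(SD\otimes SB)\xrightarrow{1\otimes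 S'(1\otimes e_{A,B})}A\otimes S'(SD\otimes S(A\otimes B)\otimes A)\xrightarrow{\;e'\;}S'(SD\otimes S(A\otimes B)),$$ the distribution $\partial_r:(B\diamond D)\otimes A\to B\diamond(D\otimes A)$ is $$S(S'D\otimes S'B)\otimes A\xrightarrow{S(e'_{A,D}\otimes1)\otimes 1}S(A\otimes S'(D\otimes A)\otimes S'B)\otimes A\xrightarrow{\;e\;}S(S'(D\otimes A)\otimes S'B);$$ the negations are $S,S'$, with evaluations $e_A=e_{A,I}:SA\otimes A\to J$ and $e'_A=e'_{A,I}:A\otimes S'A\to J$, and coevaluations $n_A:I\cong SS'I\xrightarrow{Se'_{A,I}}S(A\otimes S'A)\cong A\diamond SA$ and $n'_A:I\cong S'SI\xrightarrow{S'e_{A,I}}S'(SA\otimes A)\cong S'A\diamond A$. Let $(G,\varepsilon,\delta)$ be a comonad on $\mathcal C$ with a monoidal comonad structure $\varphi_{A,B}:GA\otimes GB\to G(A\otimes B)$, $\varphi_0:I\to GI$ (that is, $G$ is lax monoidal and $\varepsilon,\delta$ are monoidal natural transformations), and with natural transformations $\nu:S\to GSG$ and $\nu':S'\to GS'G$ lifting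 $S$ and $S'$ to $G$-coalgebras: $\varepsilon_{SG}\,\nu=S\varepsilon$ and $\delta_{SG}\,\nu=G^2S\delta\cdot G\nu_G\cdot\nu$, and likewise for $S',\nu'$. *(a) Star-autonomous comonad (symmetrized Pastro–Street).* $(G,\varphi,\nu,\nu')$ is a star-autonomous comonad if for all $A,B$ 1. $SS'GA\cong GA\cong GSS'A$ equals $GS(\nu'_A)\circ\nu_{S'GA}$; 2. $S'SGA\cong GA\cong GS'SA$ equals $GS'(\nu_A)\circ\nu'_{SGA}$; 3. $\nu_B\circ e_{A,B}\circ(1\otimes\varepsilon_A)=Ge_{GA,GB}\circ G(S\varphi_{A,B}\otimes1)\circ\varphi\circ(\nu_{A\otimes B}\otimes\delta_A)$ on $S(A\otimes B)\otimes GA$; 4. $\nu'_A\circ e'_{B,A}\circ(\varepsilon_B\otimes1)=Ge'_{GB,GA}\circ G(1\otimes S'\varphi_{A,B})\circ\varphi\circ(\delta_B\otimes\nu'_{A\otimes B})$ on $GB\otimes S'(A\otimes B)$. *(b) Comonad on the linearly distributive category with negations.* Given in addition a monoidal comonad structure $\psi_{A,B}:GA\diamond GB\to G(A\diamond B)$,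 $\psi_0:J\to GJ$ on $G$ with respect to $(\diamond,J)$, the tuple $(G,\varphi,\psi,\nu,\nu')$ satisfies the linearly distributive axioms if for all $A,B,D$ - (L1) $G\partial_l\circ\varphi\circ(1\otimes\psi)=\psi\circ(\varphi\diamond1)\circ\partial_l$ on $GA\otimes(GB\diamond GD)$; - (L2) $G\partial_r\circ\varphi\circ(\psi\otimes1)=\psi\circ(1\diamond\varphi)\circ\partial_r$ on $(GB\diamond GD)\otimes GA$; - (Le) $\psi_0\circ e_A\circ(1\otimes\varepsilon_A)=Ge_{GA}\circ\varphi\circ(\nu_A\otimes\delta_A)$ on $SA\otimes GA$; - (Ln) $G(1\diamond S\varepsilon_A)\circ Gn_A\circ\varphi_0=G(1\diamond S\delta_A)\circ\psi\circ(1\diamond\nu_{GA})\circ n_{GA}$, as maps $I\to G(A\diamond SGA)$; - (Le') $\psi_0\circ e'_A\circ(\varepsilon_A\otimes1)=Ge'_{GA}\circ\varphi\circ(\delta_A\otimes\nu'_A)$ on $GA\otimes S'A$; - (Ln') $G(S'\varepsilon_A\diamond1)\circ Gn'_A\circ\varphi_0=G(S'\delta_A\diamond1)\circ\psi\circ(\nu'_{GA}\diamond1)\circ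 n'_{GA}$, as maps $I\to G(S'GA\diamond A)$. **Proposition.** On a star-autonomous category, viewed as a linearly distributive category with negations as above, the two notions coincide. Precisely, for every monoidal comonad $(G,\varphi)$ with liftings $\nu,\nu'$ of $S,S'$: - if $(G,\varphi,\psi,\nu,\nu')$ satisfies (b) for some $\psi=(\psi,\psi_0)$, then $(G,\varphi,\nu,\nu')$ is a star-autonomous comonad; - if $(G,\varphi,\nu,\nu')$ is a star-autonomous comonad, then there is exactly one monoidal comonad structure $(\psi,\psi_0)$ on $G$ with respect to $(\diamond,J)$ such that $(G,\varphi,\psi,\nu,\nu')$ satisfies (b). -/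

import Mathlib

open CategoryTheory MonoidalCategory Opposite

universe v u

/-- A star-autonomous category structure on a (not necessarily symmetric, not necessarily strict)
monoidal category `C`: contravariant functors `S` (left star) and `S'` (right star) forming an
adjoint equivalence `S ⊣ S' : Cᵒᵖ ⥤ C`, together with a bijection
`τ : C(A ⊗ B, SD) ≃ C(A, S(B ⊗ D))` natural in `A`, `B`, `D` and compatible with the associativity
of `⊗`: the two ways of passing from `C((A ⊗ B) ⊗ D, SF)` to `C(A, S(B ⊗ (D ⊗ F)))` agree. -/
structure StarAutonomous (C : Type u) [Category.{v} C] [MonoidalCategory C] where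
  /-- the left star operation -/
  S : Cᵒᵖ ⥤ C
  /-- the right star operation -/
  S' : Cᵒᵖ ⥤ C
  adj : S.rightOp ⊣ S'
  isEquivalence : S.rightOp.IsEquivalence
  τ (A B D : C) : (A ⊗ B ⟶ S.obj (op D)) ≃ (A ⟶ S.obj (op (B ⊗ D)))
  τ_naturality {A A' B B' D D' : C} (a : A' ⟶ A) (b : B' ⟶ B) (d : D' ⟶ D)
    (f : A ⊗ B ⟶ S.obj (op D)) :
    τ A' B' D' ((a ⊗ₘ b) ≫ f ≫ S.map d.op) = a ≫ τ A B D f ≫ S.map (b ⊗ₘ d).op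
  τ_assoc (A B D F : C) (f : (A ⊗ B) ⊗ D ⟶ S.obj (op F)) :
    τ A B (D ⊗ F) (τ (A ⊗ B) D F f) =
      τ A (B ⊗ D) F ((α_ A B D).inv ≫ f) ≫ S.map (α_ B D F).inv.op

/-- A second monoidal structure on `C`, kept apart from the instance `[MonoidalCategory C]`. -/
structure SecondTensor (C : Type u) [Category.{v} C] extends MonoidalCategory C

/-- A linearly distributive category structure on the monoidal category `(C, ⊗, I)`: a second
monoidal structure `(◇, J)`, called `par`, and natural (non-invertible) linear distributions
`distL : A ⊗ (B ◇ D) ⟶ (A ⊗ B) ◇ D` and `distR : (B ◇ D) ⊗ A ⟶ B ◇ (D ⊗ A)`, subject to the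
coherence conditions with the two units, with the two associativities, and with each other.
No symmetry is assumed. -/
structure LinearlyDistributive (C : Type u) [Category.{v} C] [MonoidalCategory C] where
  par : SecondTensor C
  distL (A B D : C) : A ⊗ par.tensorObj B D ⟶ par.tensorObj (A ⊗ B) D
  distR (B D A : C) : par.tensorObj B D ⊗ A ⟶ par.tensorObj B (D ⊗ A)
  distL_naturality {A A' B B' D D' : C} (a : A ⟶ A') (b : B ⟶ B') (d : D ⟶ D') :
    (a ⊗ₘ par.tensorHom b d) ≫ distL A' B' D' = distL A B D ≫ par.tensorHom (a ⊗ₘ b) d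
  distR_naturality {A A' B B' D D' : C} (b : B ⟶ B') (d : D ⟶ D') (a : A ⟶ A') :
    (par.tensorHom b d ⊗ₘ a) ≫ distR B' D' A' = distR B D A ≫ par.tensorHom b (d ⊗ₘ a)
  distL_leftUnitor (B D : C) :
    distL (𝟙_ C) B D ≫ par.whiskerRight (λ_ B).hom D = (λ_ (par.tensorObj B D)).hom
  distR_rightUnitor (B D : C) :
    distR B D (𝟙_ C) ≫ par.whiskerLeft B (ρ_ D).hom = (ρ_ (par.tensorObj B D)).hom
  distL_parUnit (A B : C) :
    distL A B par.tensorUnit ≫ (par.rightUnitor (A ⊗ B)).hom = A ◁ (par.rightUnitor B).hom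
  distR_parUnit (D A : C) :
    distR par.tensorUnit D A ≫ (par.leftUnitor (D ⊗ A)).hom = (par.leftUnitor D).hom ▷ A
  distL_tensor (A A' B D : C) :
    distL (A ⊗ A') B D ≫ par.whiskerRight (α_ A A' B).hom D =
      (α_ A A' (par.tensorObj B D)).hom ≫ A ◁ distL A' B D ≫ distL A (A' ⊗ B) D
  distR_tensor (B D A A' : C) :
    (α_ (par.tensorObj B D) A A').hom ≫ distR B D (A ⊗ A') =
      distR B D A ▷ A' ≫ distR B (D ⊗ A) A' ≫ par.whiskerLeft B (α_ D A A').hom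
  distL_par (A B D F : C) :
    A ◁ (par.associator B D F).hom ≫ distL A B (par.tensorObj D F) =
      distL A (par.tensorObj B D) F ≫ par.whiskerRight (distL A B D) F ≫
        (par.associator (A ⊗ B) D F).hom
  distR_par (B D F A : C) :
    (par.associator B D F).hom ▷ A ≫ distR B (par.tensorObj D F) A ≫
        par.whiskerLeft B (distR D F A) =
      distR (par.tensorObj B D) F A ≫ (par.associator B D (F ⊗ A)).hom
  distL_distR (A B D A' : C) :
    distL A B D ▷ A' ≫ distR (A ⊗ B) D A' =
      (α_ A (par.tensorObj B D) A').hom ≫ A ◁ distR B D A' ≫ distL A B (D ⊗ A')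
  distR_distL (A B D F : C) :
    distR A B (par.tensorObj D F) ≫ par.whiskerLeft A (distL B D F) =
      distL (par.tensorObj A B) D F ≫ par.whiskerRight (distR A B D) F ≫
        (par.associator A (B ⊗ D) F).hom

/-- A linearly distributive category with negations: functors `S, S' : Cᵒᵖ ⥤ C` with dinatural
evaluations `e_A : SA ⊗ A ⟶ J`, `e'_A : A ⊗ S'A ⟶ J` and coevaluations `n_A : I ⟶ A ◇ SA`,
`n'_A : I ⟶ S'A ◇ A` satisfying the four triangle identities. -/
structure LinearlyDistributiveNeg (C : Type u) [Category.{v} C] [MonoidalCategory C] extends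
    LinearlyDistributive C where
  S : Cᵒᵖ ⥤ C
  S' : Cᵒᵖ ⥤ C
  ev (A : C) : S.obj (op A) ⊗ A ⟶ par.tensorUnit
  ev' (A : C) : A ⊗ S'.obj (op A) ⟶ par.tensorUnit
  coev (A : C) : 𝟙_ C ⟶ par.tensorObj A (S.obj (op A))
  coev' (A : C) : 𝟙_ C ⟶ par.tensorObj (S'.obj (op A)) A
  ev_dinatural {A B : C} (f : A ⟶ B) : S.map f.op ▷ A ≫ ev A = S.obj (op B) ◁ f ≫ ev B
  ev'_dinatural {A B : C} (f : A ⟶ B) : A ◁ S'.map f.op ≫ ev' A = f ▷ S'.obj (op B) ≫ ev' B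
  coev_dinatural {A B : C} (f : A ⟶ B) :
    coev A ≫ par.whiskerRight f _ = coev B ≫ par.whiskerLeft B (S.map f.op)
  coev'_dinatural {A B : C} (f : A ⟶ B) :
    coev' A ≫ par.whiskerLeft _ f = coev' B ≫ par.whiskerRight (S'.map f.op) B
  coev_ev (A : C) :
    (λ_ A).inv ≫ coev A ▷ A ≫ distR A (S.obj (op A)) A ≫ par.whiskerLeft A (ev A) ≫
      (par.rightUnitor A).hom = 𝟙 A
  ev_coev (A : C) :
    (ρ_ (S.obj (op A))).inv ≫ S.obj (op A) ◁ coev A ≫ distL (S.obj (op A)) A (S.obj (op A)) ≫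
      par.whiskerRight (ev A) (S.obj (op A)) ≫ (par.leftUnitor (S.obj (op A))).hom = 𝟙 _
  ev'_coev' (A : C) :
    (ρ_ A).inv ≫ A ◁ coev' A ≫ distL A (S'.obj (op A)) A ≫ par.whiskerRight (ev' A) A ≫
      (par.leftUnitor A).hom = 𝟙 A
  coev'_ev' (A : C) :
    (λ_ (S'.obj (op A))).inv ≫ coev' A ▷ S'.obj (op A) ≫ distR (S'.obj (op A)) A (S'.obj (op A)) ≫
      par.whiskerLeft (S'.obj (op A)) (ev' A) ≫ (par.rightUnitor (S'.obj (op A))).hom = 𝟙 _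

namespace StarAutonomous

noncomputable section

variable {C : Type u} [Category.{v} C] [MonoidalCategory C] (𝒮 : StarAutonomous C)

local notation "S[" A "]" => CategoryTheory.Functor.obj (StarAutonomous.S 𝒮) (op A)
local notation "T[" A "]" => CategoryTheory.Functor.obj (StarAutonomous.S' 𝒮) (op A)
local notation "P[" A "," B "]" => CategoryTheory.Functor.obj (StarAutonomous.S' 𝒮) (op (CategoryTheory.Functor.obj (StarAutonomous.S 𝒮) (op B) ⊗ CategoryTheory.Functor.obj (StarAutonomous.S 𝒮) (op A)))
local notation "Sm[" f "]" => CategoryTheory.Functor.map (StarAutonomous.S 𝒮) (Quiver.Hom.op f)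
local notation "Tm[" f "]" => CategoryTheory.Functor.map (StarAutonomous.S' 𝒮) (Quiver.Hom.op f)

/-- The component `A ≅ S'SA` of the equivalence. -/
def unit (A : C) : A ⟶ T[S[A]] := 𝒮.adj.unit.app A

/-- The component `A ≅ SS'A` of the equivalence. -/
def counit (A : C) : A ⟶ S[T[A]] := (𝒮.adj.counit.app (op A)).unop

instance isIso_unit (A : C) : IsIso (𝒮.unit A) := by
  have := 𝒮.isEquivalence
  unfold unit; infer_instance

instance isIso_counit (A : C) : IsIso (𝒮.counit A) := by
  have := 𝒮.isEquivalence
  have := 𝒮.adj.isEquivalence_right_of_isEquivalence_left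
  unfold counit; infer_instance

/-- The evaluation `e_{A,B} : S(A ⊗ B) ⊗ A ⟶ SB`, corresponding to the identity of `S(A ⊗ B)`. -/
def evalL (A B : C) : S[A ⊗ B] ⊗ A ⟶ S[B] := (𝒮.τ S[A ⊗ B] A B).symm (𝟙 _)

/-- The evaluation `e'_{B,A} : B ⊗ S'(A ⊗ B) ⟶ S'A`: the transpose under `S ⊣ S'` of the morphism
`A ⟶ S(B ⊗ S'(A ⊗ B))` corresponding to `A ⊗ B ≅ SS'(A ⊗ B)`. -/
def evalR (B A : C) : B ⊗ T[A ⊗ B] ⟶ T[A] :=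
  𝒮.unit _ ≫ Tm[𝒮.τ A B T[A ⊗ B] (𝒮.counit (A ⊗ B))]

theorem Sm_comp {A B D : C} (f : A ⟶ B) (g : B ⟶ D) : Sm[g] ≫ Sm[f] = Sm[f ≫ g] := by
  rw [op_comp, CategoryTheory.Functor.map_comp]

theorem Tm_comp {A B D : C} (f : A ⟶ B) (g : B ⟶ D) : Tm[g] ≫ Tm[f] = Tm[f ≫ g] := by
  rw [op_comp, CategoryTheory.Functor.map_comp]

@[simp] theorem Sm_id (A : C) : Sm[𝟙 A] = 𝟙 _ := by simp
@[simp] theorem Tm_id (A : C) : Tm[𝟙 A] = 𝟙 _ := by simp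

theorem unit_naturality {A B : C} (f : A ⟶ B) : f ≫ 𝒮.unit B = 𝒮.unit A ≫ Tm[Sm[f]] :=
  𝒮.adj.unit.naturality f

theorem counit_naturality {A B : C} (f : A ⟶ B) : f ≫ 𝒮.counit B = 𝒮.counit A ≫ Sm[Tm[f]] :=
  congrArg Quiver.Hom.unop (𝒮.adj.counit.naturality f.op).symm

theorem counit_naturality_assoc {A B : C} (f : A ⟶ B) {Z : C} (h : _ ⟶ Z) :
    f ≫ 𝒮.counit B ≫ h =
      𝒮.counit A ≫ Sm[Tm[f]] ≫ h := by
  simpa only [Category.assoc] using congrArg (fun k => k ≫ h) (𝒮.counit_naturality f)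

@[simp]
theorem counit_map_unit (A : C) : 𝒮.counit S[A] ≫ Sm[𝒮.unit A] = 𝟙 _ :=
  congrArg Quiver.Hom.unop (𝒮.adj.left_triangle_components A)

@[simp]
theorem counit_map_unit_assoc (A : C) {Z : C} (h : _ ⟶ Z) :
    𝒮.counit S[A] ≫ Sm[𝒮.unit A] ≫ h =
      h := by
  simpa only [Category.assoc, Category.id_comp] using congrArg (fun k => k ≫ h) (𝒮.counit_map_unit A)

@[simp]
theorem unit_map_counit (A : C) : 𝒮.unit T[A] ≫ Tm[𝒮.counit A] = 𝟙 _ :=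
  𝒮.adj.right_triangle_components (op A)

@[simp]
theorem unit_map_counit_assoc (A : C) {Z : C} (h : _ ⟶ Z) :
    𝒮.unit T[A] ≫ Tm[𝒮.counit A] ≫ h =
      h := by
  simpa only [Category.assoc, Category.id_comp] using congrArg (fun k => k ≫ h) (𝒮.unit_map_counit A)

@[simp]
theorem inv_counit (A : C) : inv (𝒮.counit S[A]) = Sm[𝒮.unit A] :=
  IsIso.inv_eq_of_hom_inv_id (𝒮.counit_map_unit A)

@[simp]
theorem inv_unit (A : C) : inv (𝒮.unit T[A]) = Tm[𝒮.counit A] :=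
  IsIso.inv_eq_of_hom_inv_id (𝒮.unit_map_counit A)

theorem tau_symm (A B D : C) (g : A ⟶ S[B ⊗ D]) :
    (𝒮.τ A B D).symm g = g ▷ B ≫ 𝒮.evalL B D := by
  rw [Equiv.symm_apply_eq]
  have h := 𝒮.τ_naturality g (𝟙 B) (𝟙 D) (𝒮.evalL B D)
  simp at h
  rw [h, evalL]; simp

@[simp]
theorem tau_evalL {A B D : C} (f : A ⊗ B ⟶ S[D]) : 𝒮.τ A B D f ▷ B ≫ 𝒮.evalL B D = f := by
  rw [← tau_symm]; simp

@[simp]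
theorem tau_evalL_assoc {A B D : C} (f : A ⊗ B ⟶ S[D]) {Z : C} (h : _ ⟶ Z) :
    𝒮.τ A B D f ▷ B ≫ 𝒮.evalL B D ≫ h =
      f ≫ h := by
  simpa only [Category.assoc] using congrArg (fun k => k ≫ h) (𝒮.tau_evalL f)

theorem tau_eq_iff {A B D : C} (f : A ⊗ B ⟶ S[D]) (g : A ⟶ S[B ⊗ D]) :
    𝒮.τ A B D f = g ↔ f = g ▷ B ≫ 𝒮.evalL B D := by
  rw [← tau_symm, Equiv.eq_symm_apply]

theorem evalL_natural {A B B' : C} (f : B' ⟶ B) :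
    Sm[A ◁ f] ▷ A ≫ 𝒮.evalL A B' = 𝒮.evalL A B ≫ Sm[f] := by
  symm
  rw [← tau_eq_iff]
  have h := 𝒮.τ_naturality (𝟙 _) (𝟙 A) f (𝒮.evalL A B)
  rw [tau_eq_iff] at h
  simp at h
  rw [tau_eq_iff, h]
  simp [evalL]

theorem evalL_dinatural {A A' B : C} (f : A' ⟶ A) :
    Sm[f ▷ B] ▷ A' ≫ 𝒮.evalL A' B = S[A ⊗ B] ◁ f ≫ 𝒮.evalL A B := by
  have h := 𝒮.τ_naturality (𝟙 _) f (𝟙 _) (𝒮.evalL A B)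
  rw [tau_eq_iff] at h
  simp only [id_tensorHom, tensorHom_id, op_id, CategoryTheory.Functor.map_id, Category.comp_id, Category.id_comp] at h
  rw [h]
  simp only [evalL, Equiv.apply_symm_apply, Category.id_comp]

theorem evalL_dinatural_assoc {A A' B : C} (f : A' ⟶ A) {Z : C} (h : _ ⟶ Z) :
    Sm[f ▷ B] ▷ A' ≫ 𝒮.evalL A' B ≫ h =
      S[A ⊗ B] ◁ f ≫ 𝒮.evalL A B ≫ h := by
  simpa only [Category.assoc] using congrArg (fun k => k ≫ h) (𝒮.evalL_dinatural f)

theorem evalL_assoc (A B D : C) :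
    (Sm[(α_ A B D).inv] ▷ A ≫ 𝒮.evalL A (B ⊗ D)) ▷ B ≫ 𝒮.evalL B D =
      (α_ _ _ _).hom ≫ 𝒮.evalL (A ⊗ B) D := by
  have h := 𝒮.τ_assoc S[(A ⊗ B) ⊗ D] A B D ((α_ _ _ _).hom ≫ 𝒮.evalL (A ⊗ B) D)
  rw [Iso.inv_hom_id_assoc, evalL, Equiv.apply_symm_apply, Category.id_comp, tau_eq_iff, tau_eq_iff] at h
  exact h.symm

/-- The evaluation `e_A : SA ⊗ A ⟶ SI = J`, that is `e_{A,I}`. -/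
def ev (A : C) : S[A] ⊗ A ⟶ S[𝟙_ C] := Sm[(ρ_ A).hom] ▷ A ≫ 𝒮.evalL A (𝟙_ C)

theorem ev_dinatural {A B : C} (f : A ⟶ B) : Sm[f] ▷ A ≫ 𝒮.ev A = S[B] ◁ f ≫ 𝒮.ev B := by
  unfold ev
  rw [whisker_exchange_assoc, ← evalL_dinatural, ← comp_whiskerRight_assoc, ← comp_whiskerRight_assoc,
    Sm_comp, Sm_comp, rightUnitor_naturality]

/-- The morphism `X ⟶ SA` corresponding to a pairing `X ⊗ A ⟶ SI`. -/
def lift {X A : C} (f : X ⊗ A ⟶ S[𝟙_ C]) : X ⟶ S[A] := 𝒮.τ X A (𝟙_ C) f ≫ Sm[(ρ_ A).inv]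

@[simp]
theorem lift_ev {X A : C} (f : X ⊗ A ⟶ S[𝟙_ C]) : 𝒮.lift f ▷ A ≫ 𝒮.ev A = f := by
  simp only [lift, ev]
  rw [← comp_whiskerRight_assoc, Category.assoc, Sm_comp, Iso.hom_inv_id, Sm_id, Category.comp_id,
    tau_evalL]

@[simp]
theorem lift_ev_assoc {X A : C} (f : X ⊗ A ⟶ S[𝟙_ C]) {Z : C} (h : _ ⟶ Z) :
    𝒮.lift f ▷ A ≫ 𝒮.ev A ≫ h =
      f ≫ h := by
  simpa only [Category.assoc] using congrArg (fun k => k ≫ h) (𝒮.lift_ev f)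

theorem ev_ext {X A : C} {f g : X ⟶ S[A]} (h : f ▷ A ≫ 𝒮.ev A = g ▷ A ≫ 𝒮.ev A) : f = g := by
  unfold ev at h
  rw [← comp_whiskerRight_assoc, ← comp_whiskerRight_assoc, ← tau_symm, ← tau_symm] at h
  have := (Equiv.injective _) h
  rwa [cancel_mono] at this

theorem evalL_ev (A B : C) : 𝒮.evalL A B ▷ B ≫ 𝒮.ev B = (α_ _ _ _).hom ≫ 𝒮.ev (A ⊗ B) := by
  unfold ev
  rw [← comp_whiskerRight_assoc, ← 𝒮.evalL_natural (A := A) (ρ_ B).hom]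
  have h := 𝒮.evalL_assoc A B (𝟙_ C)
  have h3 : (ρ_ (A ⊗ B)).hom = (α_ _ _ _).hom ≫ A ◁ (ρ_ B).hom := by simp
  rw [h3, ← Sm_comp, comp_whiskerRight, Category.assoc, ← associator_naturality_left_assoc]
  rw [← h, ← comp_whiskerRight_assoc]
  have h4 : Sm[A ◁ (ρ_ B).hom] ▷ A = (Sm[A ◁ (ρ_ B).hom] ≫ Sm[(α_ A B (𝟙_ C)).hom]) ▷ A ≫
      Sm[(α_ A B (𝟙_ C)).inv] ▷ A := by
    rw [← comp_whiskerRight, Category.assoc, Sm_comp, Iso.inv_hom_id, Sm_id, Category.comp_id]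
  rw [h4, Category.assoc, comp_whiskerRight, Category.assoc]

/-- The pairing `A ⊗ S'A ⟶ SI`, written through `A ≅ SS'A` and `e_{S'A}`; it equals `ev'` below. -/
def evR (A : C) : A ⊗ T[A] ⟶ S[𝟙_ C] := 𝒮.counit A ▷ T[A] ≫ 𝒮.ev T[A]

@[simp]
theorem unit_evR (A : C) : S[A] ◁ 𝒮.unit A ≫ 𝒮.evR S[A] = 𝒮.ev A := by
  unfold evR
  rw [whisker_exchange_assoc, ← ev_dinatural, ← comp_whiskerRight_assoc]
  simp

@[simp]
theorem unit_evR_assoc (A : C) {Z : C} (h : _ ⟶ Z) :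
    S[A] ◁ 𝒮.unit A ≫ 𝒮.evR S[A] ≫ h =
      𝒮.ev A ≫ h := by
  simpa only [Category.assoc] using congrArg (fun k => k ≫ h) (𝒮.unit_evR A)

@[simp]
theorem inv_unit_ev (A : C) : S[A] ◁ inv (𝒮.unit A) ≫ 𝒮.ev A = 𝒮.evR S[A] := by
  rw [← unit_evR, ← whiskerLeft_comp_assoc]; simp

@[simp]
theorem inv_unit_ev_assoc (A : C) {Z : C} (h : _ ⟶ Z) :
    S[A] ◁ inv (𝒮.unit A) ≫ 𝒮.ev A ≫ h =
      𝒮.evR S[A] ≫ h := by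
  simpa only [Category.assoc] using congrArg (fun k => k ≫ h) (𝒮.inv_unit_ev A)

theorem evR_dinatural {A B : C} (f : A ⟶ B) : A ◁ Tm[f] ≫ 𝒮.evR A = f ▷ T[B] ≫ 𝒮.evR B := by
  unfold evR
  rw [whisker_exchange_assoc, ← ev_dinatural, ← comp_whiskerRight_assoc, ← comp_whiskerRight_assoc,
    counit_naturality]

theorem Sm_inj {A B : C} {f g : A ⟶ B} (h : Sm[f] = Sm[g]) : f = g := by
  have := 𝒮.unit_naturality f
  rw [h, ← unit_naturality] at this
  rwa [cancel_mono] at this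

theorem evR_ext {X A : C} {f g : X ⟶ T[A]} (h : A ◁ f ≫ 𝒮.evR A = A ◁ g ≫ 𝒮.evR A) : f = g := by
  unfold evR at h
  rw [whisker_exchange_assoc, whisker_exchange_assoc, ← ev_dinatural, ← ev_dinatural,
    ← comp_whiskerRight_assoc, ← comp_whiskerRight_assoc] at h
  have := 𝒮.ev_ext h
  rw [cancel_epi] at this
  exact 𝒮.Sm_inj this

theorem counit_evalR (A B : C) :
    𝒮.counit A ≫ Sm[𝒮.evalR B A] = 𝒮.τ A B T[A ⊗ B] (𝒮.counit (A ⊗ B)) := by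
  rw [evalR, ← Sm_comp, ← counit_naturality_assoc, counit_map_unit, Category.comp_id]

theorem evalR_evR (A B : C) : A ◁ 𝒮.evalR B A ≫ 𝒮.evR A = (α_ _ _ _).inv ≫ 𝒮.evR (A ⊗ B) := by
  unfold evR
  rw [whisker_exchange_assoc, ← ev_dinatural, ← comp_whiskerRight_assoc, counit_evalR,
    Iso.eq_inv_comp, ← associator_naturality_left_assoc, ← evalL_ev, ← comp_whiskerRight_assoc,
    tau_evalL]

/-- The canonical isomorphism `SI ≅ S'I`. -/
def kappa : S[𝟙_ C] ≅ T[𝟙_ C] where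
  hom := 𝒮.unit _ ≫ Tm[𝒮.lift (λ_ S[𝟙_ C]).hom]
  inv := (λ_ _).inv ≫ 𝒮.evR _
  hom_inv_id := by
    rw [leftUnitor_inv_naturality_assoc, whiskerLeft_comp, Category.assoc, evR_dinatural,
      whisker_exchange_assoc, unit_evR, lift_ev, Iso.inv_hom_id]
  inv_hom_id := by
    apply 𝒮.evR_ext
    have h : 𝟙_ C ◁ (𝒮.unit S[𝟙_ C] ≫ Tm[𝒮.lift (λ_ S[𝟙_ C]).hom]) ≫ 𝒮.evR (𝟙_ C) =
        (λ_ _).hom := by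
      rw [whiskerLeft_comp, Category.assoc, evR_dinatural, whisker_exchange_assoc, unit_evR, lift_ev]
    rw [whiskerLeft_comp, Category.assoc, h]
    simp

/-- The evaluation `e'_A : A ⊗ S'A ⟶ S'I ≅ SI = J`, that is `e'_{A,I}`. -/
def ev' (A : C) : A ⊗ T[A] ⟶ S[𝟙_ C] := A ◁ Tm[(λ_ A).hom] ≫ 𝒮.evalR A (𝟙_ C) ≫ 𝒮.kappa.inv

theorem ev'_eq (A : C) : 𝒮.ev' A = 𝒮.evR A := by
  simp only [ev', kappa]
  have h : (λ_ (A ⊗ T[𝟙_ C ⊗ A])).inv ≫ (α_ (𝟙_ C) A T[𝟙_ C ⊗ A]).inv = (λ_ A).inv ▷ _ := by simp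
  rw [leftUnitor_inv_naturality_assoc, evalR_evR, reassoc_of% h, whisker_exchange_assoc, evR_dinatural,
    ← comp_whiskerRight_assoc, Iso.inv_hom_id, id_whiskerRight, Category.id_comp]

/-- The action of `A ◇ B = S'(SB ⊗ SA)` on morphisms. -/
def parMap {A A' B B' : C} (f : A ⟶ A') (g : B ⟶ B') : P[A, B] ⟶ P[A', B'] :=
  Tm[Sm[g] ⊗ₘ Sm[f]]

def unitIso (A : C) : A ≅ T[S[A]] := asIso (𝒮.unit A)
def counitIso (A : C) : A ≅ S[T[A]] := asIso (𝒮.counit A)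

/-- The canonical isomorphism `I ≅ SS'I ≅ SSI = SJ`. -/
def unitDual : 𝟙_ C ≅ S[S[𝟙_ C]] := 𝒮.counitIso (𝟙_ C) ≪≫ 𝒮.S.mapIso 𝒮.kappa.op

/-- The associativity of `◇`, induced by that of `⊗` and `SS'(X ⊗ Y) ≅ X ⊗ Y`. -/
def parAssoc (A B D : C) :
    P[P[A, B], D] ≅ P[A, P[B, D]] :=
  𝒮.S'.mapIso (whiskerRightIso (𝒮.counitIso (S[D] ⊗ S[B])).symm S[A] ≪≫ α_ S[D] S[B] S[A] ≪≫
    whiskerLeftIso S[D] (𝒮.counitIso (S[B] ⊗ S[A]))).op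

/-- The unit isomorphism `J ◇ A ≅ A`, where `J = SI`. -/
def parLeftUnitor (A : C) : P[S[𝟙_ C], A] ≅ A :=
  𝒮.S'.mapIso ((ρ_ S[A]).symm ≪≫ whiskerLeftIso S[A] 𝒮.unitDual).op ≪≫ (𝒮.unitIso A).symm

/-- The unit isomorphism `A ◇ J ≅ A`, where `J = SI`. -/
def parRightUnitor (A : C) : P[A, S[𝟙_ C]] ≅ A :=
  𝒮.S'.mapIso ((λ_ S[A]).symm ≪≫ whiskerRightIso 𝒮.unitDual S[A]).op ≪≫ (𝒮.unitIso A).symm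

/-- The evaluation `SA ⊗ (A ◇ B) ⟶ B`. -/
def parEv (A B : C) : S[A] ⊗ P[A, B] ⟶ B := 𝒮.evalR S[A] S[B] ≫ inv (𝒮.unit B)

theorem parEv_ev (A B : C) : S[B] ◁ 𝒮.parEv A B ≫ 𝒮.ev B = (α_ _ _ _).inv ≫ 𝒮.evR (S[B] ⊗ S[A]) := by
  rw [parEv, whiskerLeft_comp, Category.assoc, inv_unit_ev, evalR_evR]

theorem ev_ext' {X B : C} {f g : X ⟶ B} (h : S[B] ◁ f ≫ 𝒮.ev B = S[B] ◁ g ≫ 𝒮.ev B) : f = g := by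
  rw [← ev_dinatural, ← ev_dinatural] at h
  exact 𝒮.Sm_inj (𝒮.ev_ext h)

theorem parEv_ext {X A B : C} {f g : X ⟶ P[A, B]}
    (h : S[A] ◁ f ≫ 𝒮.parEv A B = S[A] ◁ g ≫ 𝒮.parEv A B) : f = g := by
  apply 𝒮.evR_ext
  have h2 := congrArg (fun k => (α_ _ _ _).hom ≫ S[B] ◁ k ≫ 𝒮.ev B) h
  simp only [whiskerLeft_comp, Category.assoc, parEv_ev, associator_inv_naturality_right_assoc,
    Iso.hom_inv_id_assoc] at h2
  exact h2

theorem parEv_map {A A' B B' : C} (f : A ⟶ A') (g : B ⟶ B') :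
    S[A'] ◁ 𝒮.parMap f g ≫ 𝒮.parEv A' B' = Sm[f] ▷ _ ≫ 𝒮.parEv A B ≫ g := by
  apply 𝒮.ev_ext'
  simp only [whiskerLeft_comp, Category.assoc, parEv_ev]
  have := 𝒮.evR_dinatural (Sm[g] ⊗ₘ Sm[f])
  rw [associator_inv_naturality_right_assoc, parMap, this, ← ev_dinatural]
  rw [whisker_exchange_assoc, parEv_ev]
  simp only [tensorHom_def', comp_whiskerRight, whiskerRight_tensor, whisker_assoc, Category.assoc,
    Iso.hom_inv_id_assoc, Iso.inv_hom_id_assoc]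

@[simp]
theorem parMap_id (A B : C) : 𝒮.parMap (𝟙 A) (𝟙 B) = 𝟙 _ := by
  simp only [parMap, Sm_id, id_tensorHom_id, Tm_id]

theorem parMap_comp {A A' A'' B B' B'' : C} (f : A ⟶ A') (f' : A' ⟶ A'') (g : B ⟶ B')
    (g' : B' ⟶ B'') : 𝒮.parMap f g ≫ 𝒮.parMap f' g' = 𝒮.parMap (f ≫ f') (g ≫ g') := by
  simp only [parMap, Tm_comp, tensorHom_comp_tensorHom, Sm_comp]

theorem unitIso_hom (A : C) : (𝒮.unitIso A).hom = 𝒮.unit A := rfl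
theorem counitIso_hom (A : C) : (𝒮.counitIso A).hom = 𝒮.counit A := rfl

theorem parAssoc_hom (A B D : C) : (𝒮.parAssoc A B D).hom =
    Tm[(𝒮.counitIso (S[D] ⊗ S[B])).inv ▷ S[A] ≫ (α_ S[D] S[B] S[A]).hom ≫
      S[D] ◁ (𝒮.counitIso (S[B] ⊗ S[A])).hom] := rfl

theorem parLeftUnitor_hom (A : C) : (𝒮.parLeftUnitor A).hom =
    Tm[(ρ_ S[A]).inv ≫ S[A] ◁ 𝒮.unitDual.hom] ≫ (𝒮.unitIso A).inv := rfl

theorem parRightUnitor_hom (A : C) : (𝒮.parRightUnitor A).hom =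
    Tm[(λ_ S[A]).inv ≫ 𝒮.unitDual.hom ▷ S[A]] ≫ (𝒮.unitIso A).inv := rfl

theorem Sm_Tm {A B : C} (f : A ⟶ B) : Sm[Tm[f]] = (𝒮.counitIso A).inv ≫ f ≫ (𝒮.counitIso B).hom := by
  rw [Iso.eq_inv_comp, counitIso_hom, counitIso_hom, counit_naturality]

theorem Sm_unitIso_inv (A : C) : Sm[(𝒮.unitIso A).inv] = (𝒮.counitIso S[A]).hom := by
  rw [← cancel_mono (Sm[(𝒮.unitIso A).hom]), Sm_comp, Iso.hom_inv_id, Sm_id, unitIso_hom, counitIso_hom,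
    counit_map_unit]

theorem Sm_parMap {A A' B B' : C} (f : A ⟶ A') (g : B ⟶ B') : Sm[𝒮.parMap f g] =
    (𝒮.counitIso _).inv ≫ (Sm[g] ⊗ₘ Sm[f]) ≫ (𝒮.counitIso (S[B] ⊗ S[A])).hom := 𝒮.Sm_Tm _

theorem Sm_parAssoc (A B D : C) : Sm[(𝒮.parAssoc A B D).hom] = (𝒮.counitIso _).inv ≫
    (𝒮.counitIso (S[D] ⊗ S[B])).inv ▷ S[A] ≫ (α_ S[D] S[B] S[A]).hom ≫
      S[D] ◁ (𝒮.counitIso (S[B] ⊗ S[A])).hom ≫ (𝒮.counitIso _).hom := by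
  rw [parAssoc_hom, Sm_Tm]; simp only [Category.assoc]

theorem Sm_parLeftUnitor (A : C) : Sm[(𝒮.parLeftUnitor A).hom] =
    (ρ_ S[A]).inv ≫ S[A] ◁ 𝒮.unitDual.hom ≫ (𝒮.counitIso _).hom := by
  rw [parLeftUnitor_hom, ← Sm_comp, Sm_Tm, Sm_unitIso_inv, Iso.hom_inv_id_assoc, Category.assoc]

theorem Sm_parRightUnitor (A : C) : Sm[(𝒮.parRightUnitor A).hom] =
    (λ_ S[A]).inv ≫ 𝒮.unitDual.hom ▷ S[A] ≫ (𝒮.counitIso _).hom := by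
  rw [parRightUnitor_hom, ← Sm_comp, Sm_Tm, Sm_unitIso_inv, Iso.hom_inv_id_assoc, Category.assoc]

/-- The monoidal structure `A ◇ B = S'(SB ⊗ SA)`, `J = SI`. -/
@[reducible] def par : MonoidalCategory C where
  tensorObj A B := P[A, B]
  tensorHom := 𝒮.parMap
  whiskerLeft A _ _ g := 𝒮.parMap (𝟙 A) g
  whiskerRight f B := 𝒮.parMap f (𝟙 B)
  tensorUnit := S[𝟙_ C]
  associator := 𝒮.parAssoc
  leftUnitor := 𝒮.parLeftUnitor
  rightUnitor := 𝒮.parRightUnitor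
  tensorHom_def f g := by rw [parMap_comp, Category.comp_id, Category.id_comp]
  id_tensorHom_id := 𝒮.parMap_id
  tensorHom_comp_tensorHom f f' g g' := 𝒮.parMap_comp _ _ _ _
  whiskerLeft_id := 𝒮.parMap_id
  id_whiskerRight := 𝒮.parMap_id
  associator_naturality f g h := by
    apply 𝒮.Sm_inj
    simp only [← Sm_comp, Sm_parMap, Sm_parAssoc, Category.assoc, Iso.hom_inv_id_assoc]
    simp [-op_tensorObj, -op_tensorUnit, MonoidalCategory.tensorHom_def, whisker_exchange_assoc]
  leftUnitor_naturality {A B} f := by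
    apply 𝒮.Sm_inj
    simp only [← Sm_comp, Sm_parMap, Sm_parLeftUnitor, Sm_id, Category.assoc, Iso.hom_inv_id_assoc]
    simp [-op_tensorObj, -op_tensorUnit, whisker_exchange_assoc]
  rightUnitor_naturality {A B} f := by
    apply 𝒮.Sm_inj
    simp only [← Sm_comp, Sm_parMap, Sm_parRightUnitor, Sm_id, Category.assoc, Iso.hom_inv_id_assoc]
    simp [-op_tensorObj, -op_tensorUnit, ← whisker_exchange_assoc]
  pentagon W X Y Z := by
    apply 𝒮.Sm_inj
    simp only [← Sm_comp, Sm_parMap, Sm_parAssoc, Sm_id, Category.assoc, Iso.hom_inv_id_assoc, id_tensorHom, tensorHom_id,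
     whiskerLeft_comp, comp_whiskerRight]
    simp [-op_tensorObj, -op_tensorUnit, whisker_exchange_assoc]
  triangle X Y := by
    apply 𝒮.Sm_inj
    simp only [← Sm_comp, Sm_parMap, Sm_parAssoc, Sm_parLeftUnitor, Sm_parRightUnitor,
      Sm_id, Category.assoc, Iso.hom_inv_id_assoc, id_tensorHom, tensorHom_id,
     whiskerLeft_comp, comp_whiskerRight]
    simp [-op_tensorObj, -op_tensorUnit, whisker_exchange_assoc]

theorem ev_unit : 𝒮.ev (𝟙_ C) = (ρ_ _).hom := by
  have h1 : 𝒮.evalL (𝟙_ C) (𝟙_ C) = Sm[(ρ_ (𝟙_ C)).inv] ▷ _ ≫ 𝒮.ev (𝟙_ C) := by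
    rw [ev, ← comp_whiskerRight_assoc, Sm_comp, Iso.hom_inv_id, Sm_id, id_whiskerRight, Category.id_comp]
  have h2 := 𝒮.evalL_ev (𝟙_ C) (𝟙_ C)
  have h3 : Sm[(ρ_ (𝟙_ C)).inv] ▷ 𝟙_ C ▷ 𝟙_ C ≫ (α_ _ _ _).hom ≫ S[𝟙_ C] ◁ (ρ_ (𝟙_ C)).hom ≫ 𝒮.ev (𝟙_ C) =
     (α_ _ _ _).hom ≫ 𝒮.ev (𝟙_ C ⊗ 𝟙_ C) := by
    rw [← ev_dinatural, associator_naturality_left_assoc, ← comp_whiskerRight_assoc, Sm_comp, Iso.hom_inv_id,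
      Sm_id, id_whiskerRight, Category.id_comp]
  rw [← h3, h1, comp_whiskerRight, Category.assoc, cancel_epi] at h2
  have h4 : (α_ S[𝟙_ C] (𝟙_ C) (𝟙_ C)).hom ≫ S[𝟙_ C] ◁ (ρ_ (𝟙_ C)).hom = (ρ_ _).hom := by simp
  rw [reassoc_of% h4] at h2
  have h5 := (cancel_epi (ρ_ _).inv).2 h2
  rw [Iso.inv_hom_id_assoc, ← rightUnitor_inv_naturality_assoc] at h5
  have h6 : ((ρ_ _).inv ≫ 𝒮.ev (𝟙_ C)) ▷ 𝟙_ C ≫ 𝒮.ev (𝟙_ C) = (𝟙 _) ▷ 𝟙_ C ≫ 𝒮.ev (𝟙_ C) := by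
    rw [id_whiskerRight, Category.id_comp, comp_whiskerRight, Category.assoc, h2,
      rightUnitor_naturality_assoc, Iso.hom_inv_id_assoc]
  have h7 := 𝒮.ev_ext h6
  rw [Iso.inv_comp_eq, Category.comp_id] at h7
  exact h7

/-- The morphism `X ⟶ S'A` corresponding to a pairing `A ⊗ X ⟶ SI`. -/
def lift' {X A : C} (f : A ⊗ X ⟶ S[𝟙_ C]) : X ⟶ T[A] := 𝒮.unit X ≫ Tm[𝒮.lift f]

@[simp]
theorem lift'_evR {X A : C} (f : A ⊗ X ⟶ S[𝟙_ C]) : A ◁ 𝒮.lift' f ≫ 𝒮.evR A = f := by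
  rw [lift', whiskerLeft_comp, Category.assoc, evR_dinatural, whisker_exchange_assoc, unit_evR, lift_ev]

@[simp]
theorem lift'_evR_assoc {X A : C} (f : A ⊗ X ⟶ S[𝟙_ C]) {Z : C} (h : _ ⟶ Z) :
    A ◁ 𝒮.lift' f ≫ 𝒮.evR A ≫ h =
      f ≫ h := by
  simpa only [Category.assoc] using congrArg (fun k => k ≫ h) (𝒮.lift'_evR f)

theorem unitDual_ev : 𝒮.unitDual.hom ▷ S[𝟙_ C] ≫ 𝒮.ev S[𝟙_ C] = (λ_ _).hom := by
  have h : 𝒮.unitDual.hom = 𝒮.counit (𝟙_ C) ≫ Sm[𝒮.kappa.hom] := rfl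
  have h2 : 𝒮.kappa.hom = 𝒮.lift' (λ_ S[𝟙_ C]).hom := rfl
  rw [h, comp_whiskerRight, Category.assoc, ev_dinatural, ← whisker_exchange_assoc, ← evR, h2, lift'_evR]

/-- The evaluation `S(S'B ⊗ S'A) ⊗ S'B ⟶ A`. -/
def parEv'' (A B : C) : S[T[B] ⊗ T[A]] ⊗ T[B] ⟶ A := 𝒮.evalL T[B] T[A] ≫ inv (𝒮.counit A)

/-- The evaluation `(A ◇ B) ⊗ S'B ⟶ A`, the transpose of `SA ⊗ (A ◇ B) ⟶ B`. -/
def parEv' (A B : C) : P[A, B] ⊗ T[B] ⟶ A :=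
  𝒮.unit _ ≫ Tm[𝒮.τ S[A] P[A, B] T[B] (𝒮.parEv A B ≫ 𝒮.counit B)] ≫ inv (𝒮.unit A)

theorem parEv'_ev (A B : C) : (α_ _ _ _).hom ≫ S[A] ◁ 𝒮.parEv' A B ≫ 𝒮.ev A =
    𝒮.parEv A B ▷ T[B] ≫ 𝒮.evR B := by
  rw [parEv', whiskerLeft_comp, Category.assoc, whiskerLeft_comp, Category.assoc, inv_unit_ev, evR_dinatural,
    whisker_exchange_assoc, unit_evR, ← associator_naturality_left_assoc, ← evalL_ev,
    ← comp_whiskerRight_assoc, tau_evalL, evR, comp_whiskerRight_assoc]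

@[simp]
theorem inv_counit_evR (A : C) : inv (𝒮.counit A) ▷ T[A] ≫ 𝒮.evR A = 𝒮.ev T[A] := by
  rw [evR, ← comp_whiskerRight_assoc]; simp

@[simp]
theorem inv_counit_evR_assoc (A : C) {Z : C} (h : _ ⟶ Z) :
    inv (𝒮.counit A) ▷ T[A] ≫ 𝒮.evR A ≫ h =
      𝒮.ev T[A] ≫ h := by
  simpa only [Category.assoc] using congrArg (fun k => k ≫ h) (𝒮.inv_counit_evR A)

theorem evR_ext' {X A : C} {f g : X ⟶ A} (h : f ▷ T[A] ≫ 𝒮.evR A = g ▷ T[A] ≫ 𝒮.evR A) : f = g := by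
  rw [evR, ← comp_whiskerRight_assoc, ← comp_whiskerRight_assoc] at h
  have := 𝒮.ev_ext h
  rwa [cancel_mono] at this

theorem parEv''_evR (A B : C) : 𝒮.parEv'' A B ▷ T[A] ≫ 𝒮.evR A = (α_ _ _ _).hom ≫ 𝒮.ev (T[B] ⊗ T[A]) := by
  rw [parEv'', comp_whiskerRight, Category.assoc, inv_counit_evR, evalL_ev]

theorem parEv''_ext {X A B : C} {f g : X ⟶ S[T[B] ⊗ T[A]]}
    (h : f ▷ T[B] ≫ 𝒮.parEv'' A B = g ▷ T[B] ≫ 𝒮.parEv'' A B) : f = g := by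
  apply 𝒮.ev_ext
  have h2 := congrArg (fun k => (α_ _ _ _).inv ≫ k ▷ T[A] ≫ 𝒮.evR A) h
  simp only [comp_whiskerRight, Category.assoc, parEv''_evR, associator_naturality_left_assoc,
    Iso.inv_hom_id_assoc] at h2
  exact h2

theorem parEv'_ext {X A B : C} {f g : X ⟶ P[A, B]}
    (h : f ▷ T[B] ≫ 𝒮.parEv' A B = g ▷ T[B] ≫ 𝒮.parEv' A B) : f = g := by
  apply 𝒮.parEv_ext
  apply 𝒮.evR_ext'
  have h2 := congrArg (fun k => (α_ _ _ _).hom ≫ S[A] ◁ k ≫ 𝒮.ev A) h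
  simp only [whiskerLeft_comp, Category.assoc, ← associator_naturality_middle_assoc, parEv'_ev] at h2
  simp only [comp_whiskerRight, Category.assoc, h2]

def parIsoHom (A B : C) : P[A, B] ⟶ S[T[B] ⊗ T[A]] := 𝒮.τ P[A, B] T[B] T[A] (𝒮.parEv' A B ≫ 𝒮.counit A)

theorem parIsoHom_ev (A B : C) : 𝒮.parIsoHom A B ▷ T[B] ≫ 𝒮.parEv'' A B = 𝒮.parEv' A B := by
  rw [parIsoHom, parEv'', tau_evalL_assoc]; simp

def parIsoInv (A B : C) : S[T[B] ⊗ T[A]] ⟶ P[A, B] :=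
  𝒮.lift' ((α_ _ _ _).hom ≫ S[B] ◁ (𝒮.lift ((α_ _ _ _).hom ≫ S[A] ◁ 𝒮.parEv'' A B ≫ 𝒮.ev A) ≫
    inv (𝒮.counit B)) ≫ 𝒮.ev B)

theorem parIsoInv_ev (A B : C) : 𝒮.parIsoInv A B ▷ T[B] ≫ 𝒮.parEv' A B = 𝒮.parEv'' A B := by
  apply 𝒮.ev_ext'
  rw [whiskerLeft_comp, Category.assoc, ← cancel_epi (α_ _ _ _).hom, ← associator_naturality_middle_assoc, parEv'_ev]
  have : S[A] ◁ 𝒮.parIsoInv A B ≫ 𝒮.parEv A B =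
      𝒮.lift ((α_ _ _ _).hom ≫ S[A] ◁ 𝒮.parEv'' A B ≫ 𝒮.ev A) ≫ inv (𝒮.counit B) := by
    apply 𝒮.ev_ext'
    rw [whiskerLeft_comp, Category.assoc, parEv_ev, associator_inv_naturality_right_assoc, parIsoInv, lift'_evR,
      Iso.inv_hom_id_assoc]
  rw [← comp_whiskerRight_assoc, this, comp_whiskerRight, Category.assoc, inv_counit_evR, lift_ev]

/-- The canonical isomorphism `A ◇ B = S'(SB ⊗ SA) ≅ S(S'B ⊗ S'A)`, the unique one compatible with
the evaluations into `A`. -/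
def parIso (A B : C) : P[A, B] ≅ S[T[B] ⊗ T[A]] where
  hom := 𝒮.parIsoHom A B
  inv := 𝒮.parIsoInv A B
  hom_inv_id := by
    apply 𝒮.parEv'_ext
    rw [comp_whiskerRight, Category.assoc, parIsoInv_ev, parIsoHom_ev]; simp
  inv_hom_id := by
    apply 𝒮.parEv''_ext
    rw [comp_whiskerRight, Category.assoc, parIsoHom_ev, parIsoInv_ev]; simp

/-- The linear distribution `A ⊗ S'(SD ⊗ SB) ⟶ A ⊗ S'(SD ⊗ (S(A ⊗ B) ⊗ A)) ⟶ S'(SD ⊗ S(A ⊗ B))`,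
the first map induced by `e_{A,B}`, the second one an instance of `e'`. -/
def distL (A B D : C) : A ⊗ P[B, D] ⟶ P[A ⊗ B, D] :=
  A ◁ Tm[(α_ _ _ _).hom ≫ S[D] ◁ 𝒮.evalL A B] ≫ 𝒮.evalR A (S[D] ⊗ S[A ⊗ B])

/-- The linear distribution `S(S'D ⊗ S'B) ⊗ A ⟶ S((A ⊗ S'(D ⊗ A)) ⊗ S'B) ⊗ A ⟶ S(S'(D ⊗ A) ⊗ S'B)`,
the first map induced by `e'_{A,D}`, the second one an instance of `e`, conjugated by `parIso`. -/
def distR (B D A : C) : P[B, D] ⊗ A ⟶ P[B, D ⊗ A] :=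
  (𝒮.parIso B D).hom ▷ A ≫ Sm[(α_ _ _ _).inv ≫ 𝒮.evalR A D ▷ T[B]] ▷ A ≫
    𝒮.evalL A (T[D ⊗ A] ⊗ T[B]) ≫ (𝒮.parIso B (D ⊗ A)).inv

/-- The coevaluation `I ≅ SS'I ⟶ S(A ⊗ S'A) ≅ S(S'SA ⊗ S'A) ≅ A ◇ SA` induced by `e'_{A,I}`. -/
def coev (A : C) : 𝟙_ C ⟶ P[A, S[A]] :=
  𝒮.counit _ ≫ Sm[inv (𝒮.unit A) ▷ T[A] ≫ A ◁ Tm[(λ_ A).hom] ≫ 𝒮.evalR A (𝟙_ C)] ≫ (𝒮.parIso A S[A]).inv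

/-- The coevaluation `I ≅ S'SI ⟶ S'(SA ⊗ A) ≅ S'(SA ⊗ SS'A) = S'A ◇ A` induced by `e_{A,I}`. -/
def coev' (A : C) : 𝟙_ C ⟶ P[T[A], A] :=
  𝒮.unit _ ≫ Tm[S[A] ◁ inv (𝒮.counit A) ≫ 𝒮.ev A]

theorem parAssoc_ev (A B D : C) :
    S[B] ◁ (S[A] ◁ (𝒮.parAssoc A B D).hom ≫ 𝒮.parEv A P[B, D]) ≫ 𝒮.parEv B D =
    (α_ _ _ _).inv ≫ 𝒮.counit (S[B] ⊗ S[A]) ▷ _ ≫ 𝒮.parEv P[A, B] D := by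
  apply 𝒮.ev_ext'
  rw [whiskerLeft_comp, Category.assoc, parEv_ev, associator_inv_naturality_right_assoc, evR,
    whisker_exchange_assoc, whiskerLeft_comp, Category.assoc, parEv_ev,
    associator_inv_naturality_right_assoc, parAssoc_hom, evR_dinatural]
  simp only [whiskerLeft_comp, Category.assoc, parEv_ev, ← counitIso_hom, comp_whiskerRight,
    associator_inv_naturality_left_assoc]
  simp [-op_tensorObj, -op_tensorUnit]

theorem parRightUnitor_ev (A : C) : S[A] ◁ (𝒮.parRightUnitor A).hom ≫ 𝒮.ev A = 𝒮.parEv A S[𝟙_ C] := by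
  have h := congrArg (fun k => (α_ _ _ _).hom ≫ k) (𝒮.parEv_ev A S[𝟙_ C])
  simp only [Iso.hom_inv_id_assoc] at h
  have h2 : (𝒮.unitIso A).inv = inv (𝒮.unit A) := by simp [unitIso]
  rw [parRightUnitor_hom, whiskerLeft_comp, Category.assoc, h2, inv_unit_ev, evR_dinatural, ← h,
    comp_whiskerRight, Category.assoc, associator_naturality_left_assoc, ← whisker_exchange_assoc,
    unitDual_ev, leftUnitor_naturality]
  simp

theorem parLeftUnitor_ev (A : C) : (λ_ _).inv ≫ 𝒮.unitDual.hom ▷ _ ≫ 𝒮.parEv S[𝟙_ C] A =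
    (𝒮.parLeftUnitor A).hom := by
  apply 𝒮.ev_ext'
  have h2 : (𝒮.unitIso A).inv = inv (𝒮.unit A) := by simp [unitIso]
  rw [parLeftUnitor_hom, whiskerLeft_comp, whiskerLeft_comp, whiskerLeft_comp, Category.assoc,
    Category.assoc, Category.assoc, parEv_ev, h2, inv_unit_ev, evR_dinatural]
  simp [-op_tensorObj, -op_tensorUnit]

theorem distL_ev (A B D : C) : S[A ⊗ B] ◁ 𝒮.distL A B D ≫ 𝒮.parEv (A ⊗ B) D =
    (α_ _ _ _).inv ≫ 𝒮.evalL A B ▷ _ ≫ 𝒮.parEv B D := by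
  apply 𝒮.ev_ext'
  simp only [whiskerLeft_comp, Category.assoc, parEv_ev]
  rw [associator_inv_naturality_right_assoc, distL, whiskerLeft_comp, Category.assoc, evalR_evR,
    associator_inv_naturality_right_assoc, evR_dinatural]
  simp

theorem distL_ev_assoc (A B D : C) {Z : C} (h : _ ⟶ Z) :
    S[A ⊗ B] ◁ 𝒮.distL A B D ≫ 𝒮.parEv (A ⊗ B) D ≫ h =
      (α_ _ _ _).inv ≫ 𝒮.evalL A B ▷ _ ≫ 𝒮.parEv B D ≫ h := by
  simpa only [Category.assoc] using congrArg (fun k => k ≫ h) (𝒮.distL_ev A B D)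

theorem distR_ev' (B D A : C) : 𝒮.distR B D A ▷ T[D ⊗ A] ≫ 𝒮.parEv' B (D ⊗ A) =
    (α_ _ _ _).hom ≫ P[B, D] ◁ 𝒮.evalR A D ≫ 𝒮.parEv' B D := by
  have h1 : (𝒮.parIso B (D ⊗ A)).inv ▷ T[D ⊗ A] ≫ 𝒮.parEv' B (D ⊗ A) = 𝒮.parEv'' B (D ⊗ A) :=
    𝒮.parIsoInv_ev _ _
  have h2 : (𝒮.parIso B D).hom ▷ T[D] ≫ 𝒮.parEv'' B D = 𝒮.parEv' B D := 𝒮.parIsoHom_ev _ _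
  have h3 := 𝒮.evalL_assoc A T[D ⊗ A] T[B]
  rw [distR, ← Sm_comp]
  simp only [comp_whiskerRight, Category.assoc] at h3 ⊢
  rw [h1, parEv'', reassoc_of% h3, associator_naturality_left_assoc, evalL_dinatural_assoc,
    ← parEv'', associator_naturality_left_assoc, ← whisker_exchange_assoc, h2]

theorem distR_ev (B D A : C) : S[B] ◁ 𝒮.distR B D A ≫ 𝒮.parEv B (D ⊗ A) =
    (α_ _ _ _).inv ≫ 𝒮.parEv B D ▷ A := by
  apply 𝒮.evR_ext'
  simp only [comp_whiskerRight, Category.assoc]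
  rw [← parEv'_ev, associator_naturality_middle_assoc, ← whiskerLeft_comp_assoc, distR_ev']
  have h := congrArg (fun k => (α_ _ _ _).inv ≫ k) (𝒮.parEv'_ev B D)
  simp only [Iso.inv_hom_id_assoc] at h
  simp only [whiskerLeft_comp, Category.assoc, h]
  rw [associator_inv_naturality_right_assoc, whisker_exchange_assoc, evalR_evR]
  simp

theorem distR_ev_assoc (B D A : C) {Z : C} (h : _ ⟶ Z) :
    S[B] ◁ 𝒮.distR B D A ≫ 𝒮.parEv B (D ⊗ A) ≫ h =
      (α_ _ _ _).inv ≫ 𝒮.parEv B D ▷ A ≫ h := by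
  simpa only [Category.assoc] using congrArg (fun k => k ≫ h) (𝒮.distR_ev B D A)

theorem evalR_unit_ev (A : C) :
    𝟙_ C ◁ (A ◁ Tm[(λ_ A).hom] ≫ 𝒮.evalR A (𝟙_ C)) ≫ 𝒮.evR (𝟙_ C) = (λ_ _).hom ≫ 𝒮.evR A := by
  have h := 𝒮.ev'_eq A
  simp only [ev', kappa] at h
  rw [← h, leftUnitor_inv_naturality_assoc]
  simp

theorem coev_ev' (A : C) : 𝒮.coev A ▷ T[S[A]] ≫ 𝒮.parEv' A S[A] = (λ_ _).hom ≫ inv (𝒮.unit A) := by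
  have h1 : (𝒮.parIso A S[A]).inv ▷ T[S[A]] ≫ 𝒮.parEv' A S[A] = 𝒮.parEv'' A S[A] :=
    𝒮.parIsoInv_ev _ _
  have h2 : (𝒮.parIso A S[A]).inv ▷ T[S[A]] ▷ T[A] ≫ 𝒮.parEv' A S[A] ▷ T[A] = 𝒮.parEv'' A S[A] ▷ T[A] := by
    rw [← comp_whiskerRight, h1]
  apply 𝒮.evR_ext'
  simp only [coev, comp_whiskerRight, Category.assoc]
  rw [reassoc_of% h2, parEv''_evR, associator_naturality_left_assoc,
    ev_dinatural, associator_naturality_left_assoc, ← whisker_exchange_assoc, ← evR,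
    whiskerLeft_comp, Category.assoc, evalR_unit_ev]
  simp

theorem coev_ev (A : C) : S[A] ◁ 𝒮.coev A ≫ 𝒮.parEv A S[A] = (ρ_ _).hom := by
  apply 𝒮.evR_ext'
  rw [comp_whiskerRight, Category.assoc, ← parEv'_ev, associator_naturality_middle_assoc,
    ← whiskerLeft_comp_assoc, coev_ev', whiskerLeft_comp, Category.assoc, inv_unit_ev]
  simp

theorem coev_ev_assoc (A : C) {Z : C} (h : _ ⟶ Z) :
    S[A] ◁ 𝒮.coev A ≫ 𝒮.parEv A S[A] ≫ h =
      (ρ_ _).hom ≫ h := by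
  simpa only [Category.assoc] using congrArg (fun k => k ≫ h) (𝒮.coev_ev A)

theorem coev'_ev (A : C) : S[T[A]] ◁ 𝒮.coev' A ≫ 𝒮.parEv T[A] A = (ρ_ _).hom ≫ inv (𝒮.counit A) := by
  apply 𝒮.ev_ext'
  simp only [whiskerLeft_comp, Category.assoc, parEv_ev]
  rw [associator_inv_naturality_right_assoc, coev', whiskerLeft_comp, Category.assoc, evR_dinatural,
    whisker_exchange_assoc, unit_evR, ev_unit]
  simp

theorem coev'_ev_assoc (A : C) {Z : C} (h : _ ⟶ Z) :
    S[T[A]] ◁ 𝒮.coev' A ≫ 𝒮.parEv T[A] A ≫ h =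
      (ρ_ _).hom ≫ inv (𝒮.counit A) ≫ h := by
  simpa only [Category.assoc] using congrArg (fun k => k ≫ h) (𝒮.coev'_ev A)

theorem parEv_whiskerLeft (A : C) {B B' : C} (g : B ⟶ B') :
    S[A] ◁ 𝒮.parMap (𝟙 A) g ≫ 𝒮.parEv A B' = 𝒮.parEv A B ≫ g := by
  rw [parEv_map, Sm_id, id_whiskerRight, Category.id_comp]

theorem parEv_whiskerRight {A A' : C} (f : A ⟶ A') (B : C) :
    S[A'] ◁ 𝒮.parMap f (𝟙 B) ≫ 𝒮.parEv A' B = Sm[f] ▷ _ ≫ 𝒮.parEv A B := by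
  rw [parEv_map, Category.comp_id]

theorem evalL_unit (B : C) : 𝒮.evalL (𝟙_ C) B = (ρ_ _).hom ≫ Sm[(λ_ B).inv] := by
  apply 𝒮.ev_ext
  rw [evalL_ev, comp_whiskerRight, Category.assoc, ev_dinatural]
  have h (X : C) : (ρ_ X).hom ▷ B ≫ X ◁ (λ_ B).inv = (α_ _ _ _).hom := by
    rw [← triangle, Category.assoc, ← whiskerLeft_comp]; simp
  rw [reassoc_of% h]

theorem distR_ev_r {X : C} (B D A : C) (f : X ⟶ P[B, D] ⊗ A) : S[B] ◁ (f ≫ 𝒮.distR B D A) ≫ 𝒮.parEv B (D ⊗ A) =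
    S[B] ◁ f ≫ (α_ _ _ _).inv ≫ 𝒮.parEv B D ▷ A := by
  rw [whiskerLeft_comp, Category.assoc, distR_ev]

theorem distL_nat {A A' B B' D D' : C} (a : A ⟶ A') (b : B ⟶ B') (d : D ⟶ D') :
    (a ⊗ₘ 𝒮.parMap b d) ≫ 𝒮.distL A' B' D' = 𝒮.distL A B D ≫ 𝒮.parMap (a ⊗ₘ b) d := by
  apply 𝒮.parEv_ext
  simp only [whiskerLeft_comp, Category.assoc, parEv_map, distL_ev]
  rw [whisker_exchange_assoc, distL_ev_assoc, associator_inv_naturality_left_assoc,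
    ← comp_whiskerRight_assoc]
  have h : Sm[a ⊗ₘ b] ▷ A ≫ 𝒮.evalL A B = S[A' ⊗ B'] ◁ a ≫ 𝒮.evalL A' B' ≫ Sm[b] := by
    rw [MonoidalCategory.tensorHom_def, ← Sm_comp, comp_whiskerRight, Category.assoc, evalL_dinatural,
      ← whisker_exchange_assoc, evalL_natural]
  rw [h]
  simp only [MonoidalCategory.tensorHom_def, whiskerLeft_comp, comp_whiskerRight, Category.assoc,
    associator_inv_naturality_right_assoc, ← associator_inv_naturality_middle_assoc]
  rw [whisker_exchange_assoc, parEv_map]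

theorem distR_nat {A A' B B' D D' : C} (b : B ⟶ B') (d : D ⟶ D') (a : A ⟶ A') :
    (𝒮.parMap b d ⊗ₘ a) ≫ 𝒮.distR B' D' A' = 𝒮.distR B D A ≫ 𝒮.parMap b (d ⊗ₘ a) := by
  apply 𝒮.parEv_ext
  simp only [whiskerLeft_comp, Category.assoc, parEv_map, distR_ev]
  rw [whisker_exchange_assoc, distR_ev_assoc, associator_inv_naturality_left_assoc,
    ← comp_whiskerRight_assoc]
  simp only [MonoidalCategory.tensorHom_def, whiskerLeft_comp, Category.assoc,
    associator_inv_naturality_right_assoc, associator_inv_naturality_middle_assoc]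
  rw [whisker_exchange, ← comp_whiskerRight_assoc, parEv_map]
  simp only [comp_whiskerRight, Category.assoc]

theorem distL_lu (B D : C) :
    𝒮.distL (𝟙_ C) B D ≫ 𝒮.parMap (λ_ B).hom (𝟙 D) = (λ_ P[B, D]).hom := by
  apply 𝒮.parEv_ext
  rw [whiskerLeft_comp, Category.assoc, parEv_whiskerRight, whisker_exchange_assoc, distL_ev,
    evalL_unit, associator_inv_naturality_left_assoc, ← comp_whiskerRight_assoc,
    rightUnitor_naturality_assoc, Sm_comp, Iso.inv_hom_id, Sm_id, Category.comp_id]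
  have h : (α_ S[B] (𝟙_ C) P[B, D]).inv ≫ (ρ_ S[B]).hom ▷ P[B, D] = S[B] ◁ (λ_ P[B, D]).hom := by simp
  rw [reassoc_of% h]

theorem distR_ru (B D : C) :
    𝒮.distR B D (𝟙_ C) ≫ 𝒮.parMap (𝟙 B) (ρ_ D).hom = (ρ_ P[B, D]).hom := by
  apply 𝒮.parEv_ext
  rw [whiskerLeft_comp, Category.assoc, parEv_whiskerLeft, distR_ev_assoc, rightUnitor_naturality]
  simp [-op_tensorObj, -op_tensorUnit]

theorem distL_pu (A B : C) :
    𝒮.distL A B S[𝟙_ C] ≫ (𝒮.parRightUnitor (A ⊗ B)).hom = A ◁ (𝒮.parRightUnitor B).hom := by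
  apply 𝒮.ev_ext'
  rw [whiskerLeft_comp, Category.assoc, parRightUnitor_ev, distL_ev, ← parRightUnitor_ev,
    ← whisker_exchange_assoc, evalL_ev, ← associator_inv_naturality_right_assoc,
    Iso.inv_hom_id_assoc]

theorem distR_pu (D A : C) :
    𝒮.distR S[𝟙_ C] D A ≫ (𝒮.parLeftUnitor (D ⊗ A)).hom = (𝒮.parLeftUnitor D).hom ▷ A := by
  rw [← parLeftUnitor_ev, ← parLeftUnitor_ev, leftUnitor_inv_naturality_assoc,
      whisker_exchange_assoc, distR_ev]
  simp [-op_tensorObj, -op_tensorUnit]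

theorem evalL_assoc' (A A' B : C) : Sm[(α_ A A' B).hom] ▷ (A ⊗ A') ≫ 𝒮.evalL (A ⊗ A') B =
    (α_ _ _ _).inv ≫ 𝒮.evalL A (A' ⊗ B) ▷ A' ≫ 𝒮.evalL A' B := by
  have h := 𝒮.evalL_assoc A A' B
  rw [Iso.eq_inv_comp, ← associator_naturality_left_assoc, ← h, ← comp_whiskerRight_assoc,
    ← comp_whiskerRight_assoc, Sm_comp, Iso.inv_hom_id, Sm_id, id_whiskerRight, Category.id_comp]

theorem distL_t (A A' B D : C) :
    𝒮.distL (A ⊗ A') B D ≫ 𝒮.parMap (α_ A A' B).hom (𝟙 D) =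
      (α_ A A' P[B, D]).hom ≫ A ◁ 𝒮.distL A' B D ≫ 𝒮.distL A (A' ⊗ B) D := by
  apply 𝒮.parEv_ext
  rw [whiskerLeft_comp, Category.assoc, parEv_whiskerRight, whisker_exchange_assoc, distL_ev]
  rw [whiskerLeft_comp, whiskerLeft_comp, Category.assoc, Category.assoc, distL_ev,
    associator_inv_naturality_right_assoc, whisker_exchange_assoc, distL_ev]
  rw [associator_inv_naturality_left_assoc, ← comp_whiskerRight_assoc, evalL_assoc']
  simp [-op_tensorObj, -op_tensorUnit]

theorem distR_t (B D A A' : C) :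
    (α_ P[B, D] A A').hom ≫ 𝒮.distR B D (A ⊗ A') =
      𝒮.distR B D A ▷ A' ≫ 𝒮.distR B (D ⊗ A) A' ≫ 𝒮.parMap (𝟙 B) (α_ D A A').hom := by
  apply 𝒮.parEv_ext
  simp only [whiskerLeft_comp, Category.assoc, parEv_whiskerLeft, distR_ev]
  rw [distR_ev_assoc, associator_inv_naturality_middle_assoc, ← comp_whiskerRight_assoc, distR_ev]
  simp [-op_tensorObj, -op_tensorUnit]

theorem parAssoc_ext {X A B D : C} {f g : X ⟶ P[A, P[B, D]]}
    (h : S[B] ◁ (S[A] ◁ f ≫ 𝒮.parEv A P[B, D]) ≫ 𝒮.parEv B D =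
      S[B] ◁ (S[A] ◁ g ≫ 𝒮.parEv A P[B, D]) ≫ 𝒮.parEv B D) : f = g :=
  𝒮.parEv_ext (𝒮.parEv_ext h)

theorem parAssoc_ev2 {X : C} (A B D : C) (f : X ⟶ P[P[A, B], D]) :
    S[B] ◁ (S[A] ◁ (f ≫ (𝒮.parAssoc A B D).hom) ≫ 𝒮.parEv A P[B, D]) ≫ 𝒮.parEv B D =
    (α_ _ _ _).inv ≫ 𝒮.counit (S[B] ⊗ S[A]) ▷ _ ≫ S[P[A, B]] ◁ f ≫ 𝒮.parEv P[A, B] D := by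
  have h := 𝒮.parAssoc_ev A B D
  simp only [whiskerLeft_comp, Category.assoc] at h ⊢
  rw [h, associator_inv_naturality_right_assoc, whisker_exchange_assoc]

theorem counit_ev (A B : C) : 𝒮.counit (S[B] ⊗ S[A]) ▷ P[A, B] ≫ 𝒮.ev P[A, B] =
    (α_ _ _ _).hom ≫ S[B] ◁ 𝒮.parEv A B ≫ 𝒮.ev B := by
  rw [parEv_ev, Iso.hom_inv_id_assoc, evR]

theorem counit_distL (A B D : C) :
    (𝒮.counit (S[D] ⊗ S[A ⊗ B]) ≫ Sm[𝒮.distL A B D]) ▷ A ≫ 𝒮.evalL A P[B, D] =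
      (α_ _ _ _).hom ≫ S[D] ◁ 𝒮.evalL A B ≫ 𝒮.counit (S[D] ⊗ S[B]) := by
  apply 𝒮.ev_ext
  simp only [comp_whiskerRight, Category.assoc, evalL_ev, counit_ev]
  rw [associator_naturality_left_assoc, associator_naturality_left_assoc, ev_dinatural,
    ← whisker_exchange_assoc, counit_ev, associator_naturality_right_assoc,
    ← whiskerLeft_comp_assoc, distL_ev]
  simp [-op_tensorObj, -op_tensorUnit]

theorem counit_distR (A B D : C) :
    (𝒮.counit (S[B ⊗ D] ⊗ S[A]) ≫ Sm[𝒮.distR A B D]) ▷ P[A, B] ≫ 𝒮.evalL P[A, B] D =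
      (α_ _ _ _).hom ≫ S[B ⊗ D] ◁ 𝒮.parEv A B ≫ 𝒮.evalL B D := by
  apply 𝒮.ev_ext
  simp only [comp_whiskerRight, Category.assoc, evalL_ev]
  rw [associator_naturality_left_assoc, associator_naturality_left_assoc, ev_dinatural,
    ← whisker_exchange_assoc, counit_ev, associator_naturality_right_assoc,
    ← whiskerLeft_comp_assoc, distR_ev]
  simp [-op_tensorObj, -op_tensorUnit]

theorem distL_p (A B D F : C) :
    A ◁ (𝒮.parAssoc B D F).hom ≫ 𝒮.distL A B P[D, F] =
      𝒮.distL A P[B, D] F ≫ 𝒮.parMap (𝒮.distL A B D) (𝟙 F) ≫ (𝒮.parAssoc (A ⊗ B) D F).hom := by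
  apply 𝒮.parAssoc_ext
  rw [← Category.assoc (𝒮.distL A P[B, D] F), parAssoc_ev2]
  rw [whiskerLeft_comp _ (𝒮.distL A P[B, D] F), Category.assoc, parEv_whiskerRight,
    whisker_exchange_assoc, distL_ev, ← comp_whiskerRight_assoc, associator_inv_naturality_left_assoc,
    ← comp_whiskerRight_assoc, counit_distL]
  have h := 𝒮.parAssoc_ev B D F
  simp only [whiskerLeft_comp, comp_whiskerRight, Category.assoc] at h ⊢
  rw [Iso.eq_inv_comp] at h
  rw [← h, ← whiskerLeft_comp_assoc _ (_ ◁ 𝒮.distL A B P[D, F]), distL_ev]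
  have hx : S[D] ◁ 𝒮.evalL A B ▷ P[P[B, D], F] ≫ S[D] ◁ S[B] ◁ (𝒮.parAssoc B D F).hom =
      S[D] ◁ (S[A ⊗ B] ⊗ A) ◁ (𝒮.parAssoc B D F).hom ≫ S[D] ◁ 𝒮.evalL A B ▷ P[B, P[D, F]] := by
    rw [← whiskerLeft_comp, ← whisker_exchange, whiskerLeft_comp]
  simp [-op_tensorObj, -op_tensorUnit, reassoc_of% hx]

theorem distR_p (B D F A : C) :
    (𝒮.parAssoc B D F).hom ▷ A ≫ 𝒮.distR B P[D, F] A ≫ 𝒮.parMap (𝟙 B) (𝒮.distR D F A) =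
      𝒮.distR P[B, D] F A ≫ (𝒮.parAssoc B D (F ⊗ A)).hom := by
  apply 𝒮.parAssoc_ext
  rw [parAssoc_ev2, distR_ev]
  have h := congrArg (fun k => k ▷ A) (𝒮.parAssoc_ev B D F)
  simp only [whiskerLeft_comp, comp_whiskerRight, Category.assoc] at h
  simp only [whiskerLeft_comp, Category.assoc, parEv_whiskerLeft, distR_ev_assoc, distR_ev]
  have hp := MonoidalCategory.pentagon_inv (W := S[D]) (X := S[B]) (Y := P[P[B, D], F]) (Z := A)
  rw [associator_inv_naturality_left_assoc, ← reassoc_of% hp, ← h]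
  simp [-op_tensorObj, -op_tensorUnit]

theorem distL_distR (A B D A' : C) :
    𝒮.distL A B D ▷ A' ≫ 𝒮.distR (A ⊗ B) D A' =
      (α_ A P[B, D] A').hom ≫ A ◁ 𝒮.distR B D A' ≫ 𝒮.distL A B (D ⊗ A') := by
  apply 𝒮.parEv_ext
  simp only [whiskerLeft_comp, Category.assoc, distR_ev, distL_ev]
  rw [associator_inv_naturality_middle_assoc, ← comp_whiskerRight, distL_ev,
    associator_inv_naturality_right_assoc, whisker_exchange_assoc, distR_ev]
  simp [-op_tensorObj, -op_tensorUnit]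

theorem distR_distL (A B D F : C) :
    𝒮.distR A B P[D, F] ≫ 𝒮.parMap (𝟙 A) (𝒮.distL B D F) =
      𝒮.distL P[A, B] D F ≫ 𝒮.parMap (𝒮.distR A B D) (𝟙 F) ≫ (𝒮.parAssoc A (B ⊗ D) F).hom := by
  apply 𝒮.parAssoc_ext
  rw [← Category.assoc (𝒮.distL P[A, B] D F), parAssoc_ev2]
  rw [whiskerLeft_comp _ (𝒮.distL P[A, B] D F), Category.assoc, parEv_whiskerRight,
    whisker_exchange_assoc, distL_ev, ← comp_whiskerRight_assoc, associator_inv_naturality_left_assoc,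
    ← comp_whiskerRight_assoc, counit_distR]
  simp only [whiskerLeft_comp, Category.assoc, parEv_whiskerLeft, distR_ev_assoc, distL_ev, comp_whiskerRight]
  simp [-op_tensorObj, -op_tensorUnit]

theorem ev'_dinatural {A B : C} (f : A ⟶ B) :
    A ◁ Tm[f] ≫ 𝒮.ev' A = f ▷ T[B] ≫ 𝒮.ev' B := by
  rw [ev'_eq, ev'_eq, evR_dinatural]

theorem coev_dinatural {A B : C} (f : A ⟶ B) :
    𝒮.coev A ≫ 𝒮.parMap f (𝟙 S[A]) = 𝒮.coev B ≫ 𝒮.parMap (𝟙 B) Sm[f] := by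
  apply 𝒮.parEv_ext
  rw [whiskerLeft_comp, whiskerLeft_comp, Category.assoc, Category.assoc, parEv_whiskerLeft,
    parEv_whiskerRight, whisker_exchange_assoc, coev_ev, coev_ev_assoc, rightUnitor_naturality]

theorem coev'_dinatural {A B : C} (f : A ⟶ B) :
    𝒮.coev' A ≫ 𝒮.parMap (𝟙 T[A]) f = 𝒮.coev' B ≫ 𝒮.parMap Tm[f] (𝟙 B) := by
  apply 𝒮.parEv_ext
  rw [whiskerLeft_comp, whiskerLeft_comp, Category.assoc, Category.assoc, parEv_whiskerLeft,
    parEv_whiskerRight, whisker_exchange_assoc, coev'_ev, coev'_ev_assoc, rightUnitor_naturality_assoc]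
  congr 1
  rw [IsIso.inv_comp_eq, ← cancel_mono (𝒮.counit B), Category.assoc, Category.assoc,
    IsIso.inv_hom_id, Category.comp_id, counit_naturality]

theorem neg1 (A : C) : (λ_ A).inv ≫ 𝒮.coev A ▷ A ≫ 𝒮.distR A S[A] A ≫ 𝒮.parMap (𝟙 A) (𝒮.ev A) ≫
    (𝒮.parRightUnitor A).hom = 𝟙 A := by
  apply 𝒮.ev_ext'
  simp only [whiskerLeft_comp, Category.assoc]
  rw [parRightUnitor_ev, parEv_whiskerLeft, distR_ev_assoc, associator_inv_naturality_middle_assoc,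
    ← comp_whiskerRight_assoc, coev_ev]
  simp [-op_tensorObj, -op_tensorUnit]

theorem parLeftUnitor_ev' {X A B : C} (f : X ⟶ P[A, B]) (g : A ⟶ S[𝟙_ C]) :
    f ≫ 𝒮.parMap g (𝟙 B) ≫ (𝒮.parLeftUnitor B).hom =
      (λ_ _).inv ≫ (𝒮.unitDual.hom ≫ Sm[g]) ▷ X ≫ S[A] ◁ f ≫ 𝒮.parEv A B := by
  rw [← parLeftUnitor_ev, leftUnitor_inv_naturality_assoc, leftUnitor_inv_naturality_assoc,
    whisker_exchange_assoc, parEv_whiskerRight, ← whisker_exchange_assoc, comp_whiskerRight_assoc,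
    whisker_exchange_assoc, whisker_exchange_assoc]

theorem unitDual_evalL {A B : C} (g : A ⊗ B ⟶ S[𝟙_ C]) :
    (𝒮.unitDual.hom ≫ Sm[g]) ▷ A ≫ 𝒮.evalL A B = (λ_ A).hom ≫ 𝒮.lift g := by
  apply 𝒮.ev_ext
  simp only [comp_whiskerRight, Category.assoc, lift_ev, evalL_ev]
  rw [associator_naturality_left_assoc, associator_naturality_left_assoc, ev_dinatural,
    ← whisker_exchange_assoc, unitDual_ev]
  simp

theorem lift_ev_self (A : C) : 𝒮.lift (𝒮.ev A) = 𝟙 _ := by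
  apply 𝒮.ev_ext
  simp

theorem lift_ev'_self (A : C) : 𝒮.lift (𝒮.ev' A) = 𝒮.counit A := by
  apply 𝒮.ev_ext
  rw [lift_ev, ev'_eq, evR]

theorem parLeftUnitor_distL {X A B D : C} (f : X ⟶ P[B, D]) (g : A ⊗ B ⟶ S[𝟙_ C]) :
    A ◁ f ≫ 𝒮.distL A B D ≫ 𝒮.parMap g (𝟙 D) ≫ (𝒮.parLeftUnitor D).hom =
      𝒮.lift g ▷ X ≫ S[B] ◁ f ≫ 𝒮.parEv B D := by
  rw [← Category.assoc, parLeftUnitor_ev', whiskerLeft_comp_assoc, distL_ev,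
    associator_inv_naturality_right_assoc, whisker_exchange_assoc, associator_inv_naturality_left_assoc,
    ← comp_whiskerRight_assoc, unitDual_evalL]
  simp [-op_tensorObj, -op_tensorUnit]

theorem neg2 (A : C) : (ρ_ S[A]).inv ≫ S[A] ◁ 𝒮.coev A ≫ 𝒮.distL S[A] A S[A] ≫
    𝒮.parMap (𝒮.ev A) (𝟙 S[A]) ≫ (𝒮.parLeftUnitor S[A]).hom = 𝟙 _ := by
  rw [parLeftUnitor_distL, coev_ev, lift_ev_self]
  simp

theorem neg3 (A : C) : (ρ_ A).inv ≫ A ◁ 𝒮.coev' A ≫ 𝒮.distL A T[A] A ≫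
    𝒮.parMap (𝒮.ev' A) (𝟙 A) ≫ (𝒮.parLeftUnitor A).hom = 𝟙 _ := by
  rw [parLeftUnitor_distL, coev'_ev, lift_ev'_self]
  simp

theorem neg4 (A : C) : (λ_ T[A]).inv ≫ 𝒮.coev' A ▷ T[A] ≫ 𝒮.distR T[A] A T[A] ≫
    𝒮.parMap (𝟙 T[A]) (𝒮.ev' A) ≫ (𝒮.parRightUnitor T[A]).hom = 𝟙 _ := by
  apply 𝒮.ev_ext'
  simp only [whiskerLeft_comp, Category.assoc]
  rw [parRightUnitor_ev, parEv_whiskerLeft, distR_ev_assoc, associator_inv_naturality_middle_assoc,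
    ← comp_whiskerRight_assoc, coev'_ev, ev'_eq, comp_whiskerRight_assoc, inv_counit_evR]
  simp [-op_tensorObj, -op_tensorUnit]

/-- The linearly distributive category of a star-autonomous category. -/
def linearlyDistributive : LinearlyDistributive C where
  par := ⟨𝒮.par⟩
  distL := 𝒮.distL
  distR := 𝒮.distR
  distL_naturality := 𝒮.distL_nat
  distR_naturality := 𝒮.distR_nat
  distL_leftUnitor := 𝒮.distL_lu
  distR_rightUnitor := 𝒮.distR_ru
  distL_parUnit := 𝒮.distL_pu
  distR_parUnit := 𝒮.distR_pu
  distL_tensor := 𝒮.distL_t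
  distR_tensor := 𝒮.distR_t
  distL_par := 𝒮.distL_p
  distR_par := 𝒮.distR_p
  distL_distR := 𝒮.distL_distR
  distR_distL := 𝒮.distR_distL

/-- A star-autonomous category viewed as a linearly distributive category with negations. -/
def toLDNeg : LinearlyDistributiveNeg C where
  toLinearlyDistributive := 𝒮.linearlyDistributive
  S := 𝒮.S
  S' := 𝒮.S'
  ev := 𝒮.ev
  ev' := 𝒮.ev'
  coev := 𝒮.coev
  coev' := 𝒮.coev'
  ev_dinatural := 𝒮.ev_dinatural
  ev'_dinatural := 𝒮.ev'_dinatural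
  coev_dinatural := 𝒮.coev_dinatural
  coev'_dinatural := 𝒮.coev'_dinatural
  coev_ev := 𝒮.neg1
  ev_coev := 𝒮.neg2
  ev'_coev' := 𝒮.neg3
  coev'_ev' := 𝒮.neg4

end

end StarAutonomous

section Comonads

variable {C : Type u} [Category.{v} C]

/-- A monoidal comonad structure on `G`: a lax monoidal structure `φ_{A,B} : GA ⊗ GB ⟶ G(A ⊗ B)`,
`φ₀ : I ⟶ GI` on the functor `G`, for which the counit and the comultiplication of `G` are
monoidal natural transformations. -/
structure MonoidalComonad [MonoidalCategory C] (G : Comonad C) where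
  lax : G.toFunctor.LaxMonoidal
  counit_isMonoidal : NatTrans.IsMonoidal G.ε
  comul_isMonoidal : NatTrans.IsMonoidal G.δ

/-- The morphism `φ_{A,B} : GA ⊗ GB ⟶ G(A ⊗ B)`. -/
abbrev MonoidalComonad.map₂ [MonoidalCategory C] {G : Comonad C} (φ : MonoidalComonad G) (A B : C) :
    G.obj A ⊗ G.obj B ⟶ G.obj (A ⊗ B) :=
  φ.lax.μ A B

/-- The morphism `φ₀ : I ⟶ GI`. -/
abbrev MonoidalComonad.map₀ [MonoidalCategory C] {G : Comonad C} (φ : MonoidalComonad G) :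
    𝟙_ C ⟶ G.obj (𝟙_ C) :=
  φ.lax.ε

/-- A monoidal comonad structure `ψ_{A,B} : GA ◇ GB ⟶ G(A ◇ B)`, `ψ₀ : J ⟶ GJ` on `G` with respect
to the par tensor `◇` of a linearly distributive category. -/
abbrev ParMonoidalComonad [MonoidalCategory C] (L : LinearlyDistributive C) (G : Comonad C) :=
  @MonoidalComonad C _ L.par.toMonoidalCategory G

/-- The morphism `ψ_{A,B} : GA ◇ GB ⟶ G(A ◇ B)`. -/
abbrev ParMonoidalComonad.map₂ [MonoidalCategory C] {L : LinearlyDistributive C} {G : Comonad C}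
    (ψ : ParMonoidalComonad L G) (A B : C) :
    L.par.tensorObj (G.obj A) (G.obj B) ⟶ G.obj (L.par.tensorObj A B) :=
  @MonoidalComonad.map₂ C _ L.par.toMonoidalCategory G ψ A B

/-- The morphism `ψ₀ : J ⟶ GJ`. -/
abbrev ParMonoidalComonad.map₀ [MonoidalCategory C] {L : LinearlyDistributive C} {G : Comonad C}
    (ψ : ParMonoidalComonad L G) : L.par.tensorUnit ⟶ G.obj L.par.tensorUnit :=
  @MonoidalComonad.map₀ C _ L.par.toMonoidalCategory G ψ

/-- Data lifting a contravariant functor `S` to the category of `G`-coalgebras: a natural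
transformation `ν : S ⟶ GSG` compatible with the counit and the comultiplication of `G`. -/
structure Lifting (G : Comonad C) (S : Cᵒᵖ ⥤ C) where
  ν : S ⟶ G.toFunctor.op ⋙ S ⋙ G.toFunctor
  counit (A : C) : ν.app (op A) ≫ G.ε.app (S.obj (op (G.obj A))) = S.map (G.ε.app A).op
  comul (A : C) : ν.app (op A) ≫ G.δ.app (S.obj (op (G.obj A))) =
    ν.app (op A) ≫ G.map (ν.app (op (G.obj A))) ≫ G.map (G.map (S.map (G.δ.app A).op))

/-- The component `ν_A : SA ⟶ GSGA`. -/
abbrev Lifting.app {G : Comonad C} {S : Cᵒᵖ ⥤ C} (σ : Lifting G S) (A : C) :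
    S.obj (op A) ⟶ G.obj (S.obj (op (G.obj A))) :=
  σ.ν.app (op A)

variable [MonoidalCategory C]

/-- The conditions on a comonad `G` on a linearly distributive category with negations, monoidal for
`⊗` through `φ` and for `◇` through `ψ`, and with `S`, `S'` lifted to `G`-coalgebras through `ν`,
`ν'` (`σ`, `σ'`), under which the linear distributions and the (co)evaluations lift to
`G`-coalgebras: compatibility with `distL`, `distR`, `e`, `n`, `e'` and `n'`. -/
structure IsLDComonad (L : LinearlyDistributiveNeg C) (G : Comonad C) (φ : MonoidalComonad G)
    (ψ : ParMonoidalComonad L.toLinearlyDistributive G) (σ : Lifting G L.S)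
    (σ' : Lifting G L.S') : Prop where
  distL (A B D : C) :
    G.obj A ◁ ψ.map₂ B D ≫ φ.map₂ A (L.par.tensorObj B D) ≫ G.map (L.distL A B D) =
      L.distL (G.obj A) (G.obj B) (G.obj D) ≫ L.par.whiskerRight (φ.map₂ A B) (G.obj D) ≫
        ψ.map₂ (A ⊗ B) D
  distR (A B D : C) :
    ψ.map₂ B D ▷ G.obj A ≫ φ.map₂ (L.par.tensorObj B D) A ≫ G.map (L.distR B D A) =
      L.distR (G.obj B) (G.obj D) (G.obj A) ≫ L.par.whiskerLeft (G.obj B) (φ.map₂ D A) ≫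
        ψ.map₂ B (D ⊗ A)
  ev (A : C) :
    L.S.obj (op A) ◁ G.ε.app A ≫ L.ev A ≫ ψ.map₀ =
      (σ.app A ⊗ₘ G.δ.app A) ≫ φ.map₂ (L.S.obj (op (G.obj A))) (G.obj A) ≫ G.map (L.ev (G.obj A))
  coev (A : C) :
    φ.map₀ ≫ G.map (L.coev A) ≫ G.map (L.par.whiskerLeft A (L.S.map (G.ε.app A).op)) =
      L.coev (G.obj A) ≫ L.par.whiskerLeft (G.obj A) (σ.app (G.obj A)) ≫
        ψ.map₂ A (L.S.obj (op (G.obj (G.obj A)))) ≫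
        G.map (L.par.whiskerLeft A (L.S.map (G.δ.app A).op))
  ev' (A : C) :
    G.ε.app A ▷ L.S'.obj (op A) ≫ L.ev' A ≫ ψ.map₀ =
      (G.δ.app A ⊗ₘ σ'.app A) ≫ φ.map₂ (G.obj A) (L.S'.obj (op (G.obj A))) ≫ G.map (L.ev' (G.obj A))
  coev' (A : C) :
    φ.map₀ ≫ G.map (L.coev' A) ≫ G.map (L.par.whiskerRight (L.S'.map (G.ε.app A).op) A) =
      L.coev' (G.obj A) ≫ L.par.whiskerRight (σ'.app (G.obj A)) (G.obj A) ≫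
        ψ.map₂ (L.S'.obj (op (G.obj (G.obj A)))) A ≫
        G.map (L.par.whiskerRight (L.S'.map (G.δ.app A).op) A)

/-- The conditions making a monoidal comonad `G` on a star-autonomous category, with `S`, `S'` lifted
to `G`-coalgebras through `ν`, `ν'` (`σ`, `σ'`), a star-autonomous comonad: compatibility with
`SS'G ≅ G ≅ GSS'`, with `S'SG ≅ G ≅ GS'S`, with `e_{A,B}` and with `e'_{B,A}`. -/
structure IsStarComonad (𝒮 : StarAutonomous C) (G : Comonad C) (φ : MonoidalComonad G)
    (σ : Lifting G 𝒮.S) (σ' : Lifting G 𝒮.S') : Prop where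
  counit (A : C) :
    inv (𝒮.counit (G.obj A)) ≫ G.map (𝒮.counit A) =
      σ.app (𝒮.S'.obj (op (G.obj A))) ≫ G.map (𝒮.S.map (σ'.app A).op)
  unit (A : C) :
    inv (𝒮.unit (G.obj A)) ≫ G.map (𝒮.unit A) =
      σ'.app (𝒮.S.obj (op (G.obj A))) ≫ G.map (𝒮.S'.map (σ.app A).op)
  evalL (A B : C) :
    𝒮.S.obj (op (A ⊗ B)) ◁ G.ε.app A ≫ 𝒮.evalL A B ≫ σ.app B =
      (σ.app (A ⊗ B) ⊗ₘ G.δ.app A) ≫ φ.map₂ (𝒮.S.obj (op (G.obj (A ⊗ B)))) (G.obj A) ≫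
        G.map (𝒮.S.map (φ.map₂ A B).op ▷ G.obj A) ≫ G.map (𝒮.evalL (G.obj A) (G.obj B))
  evalR (A B : C) :
    G.ε.app B ▷ 𝒮.S'.obj (op (A ⊗ B)) ≫ 𝒮.evalR B A ≫ σ'.app A =
      (G.δ.app B ⊗ₘ σ'.app (A ⊗ B)) ≫ φ.map₂ (G.obj B) (𝒮.S'.obj (op (G.obj (A ⊗ B)))) ≫
        G.map (G.obj B ◁ 𝒮.S'.map (φ.map₂ A B).op) ≫ G.map (𝒮.evalR (G.obj B) (G.obj A))

end Comonads

/-!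
A morphism between `G`-coalgebras means a morphism of `C` commuting with the structure morphisms
(`StarComonad.IsHom`). The structures `φ`, `ν`, `ν'` lift `⊗`, `S`, `S'` from `C` to `G`-coalgebras,
and `ψ` lifts `◇`. Each axiom of the two notions is equivalent to the assertion that one structure
morphism of `C` is a morphism of coalgebras whenever its arguments are coalgebras: cofree coalgebras and
the counit give back the axiom, and composing the axiom with the structure morphisms of coalgebras gives
the assertion. Hence a star-autonomous comonad is the same as a lift of the star-autonomous structure to
coalgebras (`StarLifts`), and a comonad on the linearly distributive category with negations is the same
as a lift of that structure (`LDLifts`).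

If the linearly distributive structure lifts, then so does every morphism that can be written in terms
of it. The transposes of pairings `X ⊗ A ⟶ J` and `A ⊗ X ⟶ J` are such composites of coevaluations,
distributions and unit isomorphisms (`lift_eq`, `lift'_eq`). The isomorphisms `A ≅ SS'A`, `A ≅ S'SA`
and the evaluations `e_{A,B}`, `e'_{B,A}` are transposes of pairings built from `e` and `e'`, so the
star-autonomous structure lifts (`LDLifts.starLifts`).

Conversely, if the star-autonomous structure lifts, put on `A ◇ B = S'(SB ⊗ SA)` the coalgebra structure
given by the lifts of `⊗`, `S` and `S'`. The structure morphisms of `◇`, the distributions and the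
(co)evaluations are defined through the star-autonomous structure and `τ`, and `τ` can be expressed by
`e'` (`tau_eq`), so they are all morphisms of coalgebras. A lift of a monoidal structure to coalgebras
comes from a monoidal comonad structure (`TensorLift.monoidalComonad`), which gives `ψ`.

For uniqueness, `ψ` is determined by the coalgebra structures on `GA ◇ GB` and `J`. The identity of
`A ◇ B` is a composite of `n_A`, a distribution and the evaluation `SA ⊗ (A ◇ B) ⟶ B` (`coev_parEv`);
using one lift for the distribution and the coevaluation and another one for the evaluation shows that
it is a morphism of coalgebras between the two lifts of `A ◇ B`. The structure on `J` is fixed by `e_I`, which is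
invertible.
-/

namespace StarComonad

/-! ### Coalgebras of a comonad and lifts of a monoidal structure -/

section Coalgebras

variable {C : Type u} [Category.{v} C] {G : Comonad C}

/-- The assertion that `f`, a morphism between the underlying objects of two `G`-coalgebras, is a
morphism of coalgebras. A predicate is used instead of the category of coalgebras so that `f` can be
any expression in the base category. -/
def IsHom (X Y : G.Coalgebra) (f : X.A ⟶ Y.A) : Prop :=
  X.a ≫ G.map f = f ≫ Y.a

/-- The cofree coalgebra `(GA, δ_A)`. -/
abbrev cofree (G : Comonad C) (A : C) : G.Coalgebra where
  A := G.obj A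
  a := G.δ.app A
  counit := G.left_counit A
  coassoc := (G.coassoc A).symm

variable {X Y Z : G.Coalgebra}

theorem IsHom.id (X : G.Coalgebra) : IsHom X X (𝟙 X.A) := by simp [IsHom]

theorem IsHom.comp {f : X.A ⟶ Y.A} {g : Y.A ⟶ Z.A} (hf : IsHom X Y f) (hg : IsHom Y Z g) :
    IsHom X Z (f ≫ g) := by
  unfold IsHom at *
  rw [Functor.map_comp, reassoc_of% hf, hg, Category.assoc]

theorem IsHom.of_inverse {f : X.A ⟶ Y.A} {g : Y.A ⟶ X.A} (hf : IsHom X Y f) (h₁ : f ≫ g = 𝟙 _)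
    (h₂ : g ≫ f = 𝟙 _) : IsHom Y X g := by
  have : IsIso f := ⟨g, h₁, h₂⟩
  unfold IsHom at *
  rw [← cancel_epi f, ← Category.assoc, ← hf, Category.assoc, ← Functor.map_comp, h₁,
    reassoc_of% h₁]
  simp

theorem IsHom.iso_inv {i : X.A ≅ Y.A} (h : IsHom X Y i.hom) : IsHom Y X i.inv :=
  h.of_inverse i.hom_inv_id i.inv_hom_id

theorem IsHom.isIso_inv {f : X.A ⟶ Y.A} [IsIso f] (h : IsHom X Y f) : IsHom Y X (inv f) :=
  h.of_inverse (IsIso.hom_inv_id f) (IsIso.inv_hom_id f)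

/-- The structure morphism of a coalgebra is a morphism into the cofree coalgebra. -/
theorem isHom_structure (X : G.Coalgebra) : IsHom X (cofree G X.A) X.a := X.coassoc.symm

theorem map_counit {A B : C} (f : A ⟶ B) : G.map f ≫ G.ε.app B = G.ε.app A ≫ f :=
  G.ε.naturality f

theorem map_comul {A B : C} (f : A ⟶ B) :
    G.map f ≫ G.δ.app B = G.δ.app A ≫ G.map (G.map f) :=
  G.δ.naturality f

theorem isHom_cofree_map {A B : C} (f : A ⟶ B) : IsHom (cofree G A) (cofree G B) (G.map f) :=
  (map_comul f).symm

section Tensor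

variable [MonoidalCategory C] (φ : MonoidalComonad G)

theorem map₂_natural {A A' B B' : C} (f : A ⟶ A') (g : B ⟶ B') :
    (G.map f ⊗ₘ G.map g) ≫ φ.map₂ A' B' = φ.map₂ A B ≫ G.map (f ⊗ₘ g) := by
  let := φ.lax
  exact Functor.LaxMonoidal.μ_natural G.toFunctor f g

theorem map₂_natural_assoc {A A' B B' : C} (f : A ⟶ A') (g : B ⟶ B') {Z : C}
    (h : G.obj (A' ⊗ B') ⟶ Z) :
    (G.map f ⊗ₘ G.map g) ≫ φ.map₂ A' B' ≫ h = φ.map₂ A B ≫ G.map (f ⊗ₘ g) ≫ h := by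
  rw [← Category.assoc, map₂_natural, Category.assoc]

theorem map₂_associativity (A B D : C) :
    φ.map₂ A B ▷ G.obj D ≫ φ.map₂ (A ⊗ B) D ≫ G.map (α_ A B D).hom =
      (α_ (G.obj A) (G.obj B) (G.obj D)).hom ≫ G.obj A ◁ φ.map₂ B D ≫ φ.map₂ A (B ⊗ D) :=
  φ.lax.associativity A B D

theorem map₂_left_unitality (A : C) :
    (λ_ (G.obj A)).hom = φ.map₀ ▷ G.obj A ≫ φ.map₂ (𝟙_ C) A ≫ G.map (λ_ A).hom :=
  φ.lax.left_unitality A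

theorem map₂_right_unitality (A : C) :
    (ρ_ (G.obj A)).hom = G.obj A ◁ φ.map₀ ≫ φ.map₂ A (𝟙_ C) ≫ G.map (ρ_ A).hom :=
  φ.lax.right_unitality A

theorem map₂_counit (A B : C) :
    φ.map₂ A B ≫ G.ε.app (A ⊗ B) = G.ε.app A ⊗ₘ G.ε.app B := by
  let := φ.lax
  have := φ.counit_isMonoidal.tensor A B
  simpa using this

theorem map₀_counit : φ.map₀ ≫ G.ε.app (𝟙_ C) = 𝟙 _ := by
  let := φ.lax
  have := φ.counit_isMonoidal.unit
  simpa using this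

theorem map₂_comul (A B : C) :
    φ.map₂ A B ≫ G.δ.app (A ⊗ B) =
      (G.δ.app A ⊗ₘ G.δ.app B) ≫ φ.map₂ (G.obj A) (G.obj B) ≫ G.map (φ.map₂ A B) := by
  let := φ.lax
  have := φ.comul_isMonoidal.tensor A B
  simpa using this

theorem map₀_comul : φ.map₀ ≫ G.δ.app (𝟙_ C) = φ.map₀ ≫ G.map φ.map₀ := by
  let := φ.lax
  have := φ.comul_isMonoidal.unit
  simpa using this

/-- The tensor product of coalgebras for a monoidal comonad. -/
abbrev tens (X Y : G.Coalgebra) : G.Coalgebra where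
  A := X.A ⊗ Y.A
  a := (X.a ⊗ₘ Y.a) ≫ φ.map₂ X.A Y.A
  counit := by
    rw [Category.assoc, map₂_counit, tensorHom_comp_tensorHom, X.counit, Y.counit,
      id_tensorHom_id]
  coassoc := by
    rw [Category.assoc, map₂_comul, tensorHom_comp_tensorHom_assoc, X.coassoc, Y.coassoc,
      ← tensorHom_comp_tensorHom_assoc, map₂_natural_assoc]
    simp

/-- The coalgebra structure of the tensor unit for a monoidal comonad. -/
abbrev unitC : G.Coalgebra where
  A := 𝟙_ C
  a := φ.map₀
  counit := map₀_counit φ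
  coassoc := map₀_comul φ

variable {φ}

theorem IsHom.tensorHom {X' Y' : G.Coalgebra} {f : X.A ⟶ X'.A} {g : Y.A ⟶ Y'.A}
    (hf : IsHom X X' f) (hg : IsHom Y Y' g) : IsHom (tens φ X Y) (tens φ X' Y') (f ⊗ₘ g) := by
  unfold IsHom at *
  dsimp only
  rw [Category.assoc, ← map₂_natural, tensorHom_comp_tensorHom_assoc, hf, hg,
    tensorHom_comp_tensorHom_assoc]

theorem IsHom.whiskerLeft (X : G.Coalgebra) {g : Y.A ⟶ Z.A} (hg : IsHom Y Z g) :
    IsHom (tens φ X Y) (tens φ X Z) (X.A ◁ g) := by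
  rw [← id_tensorHom]; exact (IsHom.id X).tensorHom hg

theorem IsHom.whiskerRight {g : Y.A ⟶ Z.A} (hg : IsHom Y Z g) (X : G.Coalgebra) :
    IsHom (tens φ Y X) (tens φ Z X) (g ▷ X.A) := by
  rw [← tensorHom_id]; exact hg.tensorHom (IsHom.id X)

theorem isHom_associator (X Y Z : G.Coalgebra) :
    IsHom (tens φ (tens φ X Y) Z) (tens φ X (tens φ Y Z)) (α_ X.A Y.A Z.A).hom := by
  have h := map₂_associativity φ X.A Y.A Z.A
  unfold IsHom
  simp only [tensorHom_def', MonoidalCategory.whiskerLeft_comp, comp_whiskerRight,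
    Category.assoc] at h ⊢
  rw [h]
  simp [whisker_exchange_assoc]

theorem isHom_associator_inv (X Y Z : G.Coalgebra) :
    IsHom (tens φ X (tens φ Y Z)) (tens φ (tens φ X Y) Z) (α_ X.A Y.A Z.A).inv :=
  IsHom.iso_inv (X := tens φ (tens φ X Y) Z) (Y := tens φ X (tens φ Y Z))
    (isHom_associator X Y Z)

theorem isHom_leftUnitor (X : G.Coalgebra) : IsHom (tens φ (unitC φ) X) X (λ_ X.A).hom := by
  have h := map₂_left_unitality φ X.A
  unfold IsHom
  simp only [tensorHom_def', Category.assoc]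
  rw [← h]
  simp

theorem isHom_leftUnitor_inv (X : G.Coalgebra) : IsHom X (tens φ (unitC φ) X) (λ_ X.A).inv :=
  IsHom.iso_inv (X := tens φ (unitC φ) X) (Y := X) (isHom_leftUnitor X)

theorem isHom_rightUnitor (X : G.Coalgebra) : IsHom (tens φ X (unitC φ)) X (ρ_ X.A).hom := by
  have h := map₂_right_unitality φ X.A
  unfold IsHom
  simp only [MonoidalCategory.tensorHom_def, Category.assoc]
  rw [← h]
  simp

theorem isHom_rightUnitor_inv (X : G.Coalgebra) : IsHom X (tens φ X (unitC φ)) (ρ_ X.A).inv :=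
  IsHom.iso_inv (X := tens φ X (unitC φ)) (Y := X) (isHom_rightUnitor X)

/-- A monoidal comonad structure is recovered from the tensor products of cofree coalgebras. -/
theorem map₂_eq (A B : C) :
    φ.map₂ A B = (tens φ (cofree G A) (cofree G B)).a ≫ G.map (G.ε.app A ⊗ₘ G.ε.app B) := by
  dsimp only
  rw [Category.assoc, ← map₂_natural, tensorHom_comp_tensorHom_assoc]
  simp

theorem MonoidalComonad.ext' {φ ψ : MonoidalComonad G} (h₀ : φ.map₀ = ψ.map₀)
    (h₂ : ∀ A B, φ.map₂ A B = ψ.map₂ A B) : φ = ψ := by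
  obtain ⟨⟨e, m, _, _, _, _, _⟩, _, _⟩ := φ
  obtain ⟨⟨e', m', _, _, _, _, _⟩, _, _⟩ := ψ
  obtain rfl : e = e' := h₀
  obtain rfl : m = m' := funext fun A => funext fun B => h₂ A B
  rfl

variable (G) in
/-- A lift of the monoidal structure of `C` to the `G`-coalgebras: coalgebra structures on the tensor
unit and on the tensor products of coalgebras for which the tensor products of morphisms and the
coherence isomorphisms are morphisms of coalgebras. -/
structure TensorLift where
  a (X Y : G.Coalgebra) : X.A ⊗ Y.A ⟶ G.obj (X.A ⊗ Y.A)
  a₀ : 𝟙_ C ⟶ G.obj (𝟙_ C)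
  counit (X Y : G.Coalgebra) : a X Y ≫ G.ε.app _ = 𝟙 _
  coassoc (X Y : G.Coalgebra) : a X Y ≫ G.δ.app _ = a X Y ≫ G.map (a X Y)
  counit₀ : a₀ ≫ G.ε.app _ = 𝟙 _
  coassoc₀ : a₀ ≫ G.δ.app _ = a₀ ≫ G.map a₀
  tensorHom {X X' Y Y' : G.Coalgebra} {f : X.A ⟶ X'.A} {g : Y.A ⟶ Y'.A} (hf : IsHom X X' f)
    (hg : IsHom Y Y' g) : a X Y ≫ G.map (f ⊗ₘ g) = (f ⊗ₘ g) ≫ a X' Y'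
  associator (X Y Z : G.Coalgebra) :
    a ⟨X.A ⊗ Y.A, a X Y, counit X Y, coassoc X Y⟩ Z ≫ G.map (α_ X.A Y.A Z.A).hom =
      (α_ X.A Y.A Z.A).hom ≫ a X ⟨Y.A ⊗ Z.A, a Y Z, counit Y Z, coassoc Y Z⟩
  leftUnitor (X : G.Coalgebra) :
    a ⟨𝟙_ C, a₀, counit₀, coassoc₀⟩ X ≫ G.map (λ_ X.A).hom = (λ_ X.A).hom ≫ X.a
  rightUnitor (X : G.Coalgebra) :
    a X ⟨𝟙_ C, a₀, counit₀, coassoc₀⟩ ≫ G.map (ρ_ X.A).hom = (ρ_ X.A).hom ≫ X.a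

namespace TensorLift

variable (P : TensorLift G)

/-- The tensor product of coalgebras given by a lift of the monoidal structure. -/
abbrev obj (X Y : G.Coalgebra) : G.Coalgebra := ⟨X.A ⊗ Y.A, P.a X Y, P.counit X Y, P.coassoc X Y⟩

/-- The unit coalgebra given by a lift of the monoidal structure. -/
abbrev unitObj : G.Coalgebra := ⟨𝟙_ C, P.a₀, P.counit₀, P.coassoc₀⟩

/-- The morphism `GA ⊗ GB ⟶ G(A ⊗ B)` obtained from the coalgebra structure of `GA ⊗ GB`. -/
def μ (A B : C) : G.obj A ⊗ G.obj B ⟶ G.obj (A ⊗ B) :=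
  P.a (cofree G A) (cofree G B) ≫ G.map (G.ε.app A ⊗ₘ G.ε.app B)

/-- `X.a` and `Y.a` are morphisms into cofree coalgebras, so `P.a X Y` is determined by its values at
these. -/
theorem structure_μ (X Y : G.Coalgebra) : (X.a ⊗ₘ Y.a) ≫ P.μ X.A Y.A = P.a X Y := by
  have h := P.tensorHom (isHom_structure X) (isHom_structure Y)
  rw [μ, ← reassoc_of% h, ← Functor.map_comp, tensorHom_comp_tensorHom, X.counit, Y.counit]
  simp

theorem μ_natural {A A' B B' : C} (f : A ⟶ A') (g : B ⟶ B') :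
    (G.map f ⊗ₘ G.map g) ≫ P.μ A' B' = P.μ A B ≫ G.map (f ⊗ₘ g) := by
  have h := P.tensorHom (isHom_cofree_map f) (isHom_cofree_map g)
  rw [μ, ← reassoc_of% h, μ, Category.assoc, ← Functor.map_comp, ← Functor.map_comp,
    tensorHom_comp_tensorHom, tensorHom_comp_tensorHom, map_counit, map_counit]

theorem μ_counit (A B : C) : P.μ A B ≫ G.ε.app (A ⊗ B) = G.ε.app A ⊗ₘ G.ε.app B := by
  have h := map_counit (G := G) (G.ε.app A ⊗ₘ G.ε.app B)
  rw [μ, Category.assoc]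
  -- In `h` the objects `A`, `B` appear as `(𝟭 C).obj A`, `(𝟭 C).obj B`.
  erw [h]
  rw [← Category.assoc, P.counit, Category.id_comp]

theorem μ_comul (A B : C) :
    P.μ A B ≫ G.δ.app (A ⊗ B) =
      (G.δ.app A ⊗ₘ G.δ.app B) ≫ P.μ (G.obj A) (G.obj B) ≫ G.map (P.μ A B) := by
  have h := map_comul (G := G) (G.ε.app A ⊗ₘ G.ε.app B)
  have h1 := P.structure_μ (cofree G A) (cofree G B)
  have h2 := P.coassoc (cofree G A) (cofree G B)
  dsimp only at h1 h2
  rw [reassoc_of% h1, μ, Functor.map_comp, ← reassoc_of% h2, Category.assoc]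
  -- In `h` the objects `A`, `B` appear as `(𝟭 C).obj A`, `(𝟭 C).obj B`.
  erw [h]

/-- This is the compatibility of the associator with the structures of cofree coalgebras, composed with
`G(ε ⊗ (ε ⊗ ε))`. -/
theorem μ_associativity (A B D : C) :
    P.μ A B ▷ G.obj D ≫ P.μ (A ⊗ B) D ≫ G.map (α_ A B D).hom =
      (α_ (G.obj A) (G.obj B) (G.obj D)).hom ≫ G.obj A ◁ P.μ B D ≫ P.μ A (B ⊗ D) := by
  have h := P.associator (cofree G A) (cofree G B) (cofree G D)
  have h1 := P.structure_μ (P.obj (cofree G A) (cofree G B)) (cofree G D)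
  have h2 := P.structure_μ (cofree G A) (P.obj (cofree G B) (cofree G D))
  rw [← h1, ← h2] at h
  have h3 := congrArg (fun k => k ≫ G.map (G.ε.app A ⊗ₘ (G.ε.app B ⊗ₘ G.ε.app D))) h
  dsimp only at h3
  simp only [Category.assoc] at h3
  have h4 := P.μ_natural (G.ε.app A) (G.ε.app B ⊗ₘ G.ε.app D)
  have h5 := P.μ_natural (G.ε.app A ⊗ₘ G.ε.app B) (G.ε.app D)
  have h6 := associator_naturality (G.ε.app A) (G.ε.app B) (G.ε.app D)
  dsimp only [Functor.id_obj] at h3 h4 h5 h6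
  rw [← Functor.map_comp, ← h6, Functor.map_comp, ← h4, ← reassoc_of% h5,
    tensorHom_comp_tensorHom_assoc, tensorHom_comp_tensorHom_assoc, G.right_counit,
    G.right_counit] at h3
  rw [← tensorHom_id, ← id_tensorHom]
  exact h3

theorem μ_leftUnitality (A : C) :
    (λ_ (G.obj A)).hom = P.a₀ ▷ G.obj A ≫ P.μ (𝟙_ C) A ≫ G.map (λ_ A).hom := by
  have h := P.leftUnitor (cofree G A)
  have h1 := P.structure_μ P.unitObj (cofree G A)
  rw [← h1] at h
  have h3 := congrArg (fun k => k ≫ G.map (G.ε.app A)) h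
  have h4 := P.μ_natural (𝟙 (𝟙_ C)) (G.ε.app A)
  have h5 := leftUnitor_naturality (G.ε.app A)
  dsimp only [Functor.id_obj] at h3 h4 h5
  rw [id_tensorHom] at h4
  simp only [Category.assoc] at h3
  rw [← Functor.map_comp, ← h5, Functor.map_comp, ← reassoc_of% h4,
    tensorHom_comp_tensorHom_assoc, G.right_counit, Category.comp_id] at h3
  rw [← h3]
  simp

theorem μ_rightUnitality (A : C) :
    (ρ_ (G.obj A)).hom = G.obj A ◁ P.a₀ ≫ P.μ A (𝟙_ C) ≫ G.map (ρ_ A).hom := by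
  have h := P.rightUnitor (cofree G A)
  have h1 := P.structure_μ (cofree G A) P.unitObj
  rw [← h1] at h
  have h3 := congrArg (fun k => k ≫ G.map (G.ε.app A)) h
  have h4 := P.μ_natural (G.ε.app A) (𝟙 (𝟙_ C))
  have h5 := rightUnitor_naturality (G.ε.app A)
  dsimp only [Functor.id_obj] at h3 h4 h5
  rw [tensorHom_id] at h4
  simp only [Category.assoc] at h3
  rw [← Functor.map_comp, ← h5, Functor.map_comp, ← reassoc_of% h4,
    tensorHom_comp_tensorHom_assoc, G.right_counit, Category.comp_id] at h3
  rw [← h3]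
  simp

/-- The monoidal comonad structure corresponding to a lift of the monoidal structure. -/
def monoidalComonad : MonoidalComonad G :=
  letI lax : G.toFunctor.LaxMonoidal :=
    { ε := P.a₀
      μ := P.μ
      μ_natural_left := fun f X => by simpa using P.μ_natural f (𝟙 X)
      μ_natural_right := fun X f => by simpa using P.μ_natural (𝟙 X) f
      associativity := P.μ_associativity
      left_unitality := P.μ_leftUnitality
      right_unitality := P.μ_rightUnitality }
  { lax := lax
    counit_isMonoidal :=
      { unit := by simp; exact P.counit₀
        tensor := fun A B => by simp; exact P.μ_counit A B }
    comul_isMonoidal :=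
      { unit := by simp; exact P.coassoc₀
        tensor := fun A B => by simp; exact P.μ_comul A B } }

theorem structure_monoidalComonad (X Y : G.Coalgebra) :
    (X.a ⊗ₘ Y.a) ≫ P.monoidalComonad.map₂ X.A Y.A = P.a X Y :=
  P.structure_μ X Y

end TensorLift

end Tensor

end Coalgebras

/-! ### Lifts of a contravariant functor -/

section LiftedFunctor

variable {C : Type u} [Category.{v} C] {G : Comonad C} {S : Cᵒᵖ ⥤ C} (σ : Lifting G S)

theorem lifting_natural {A B : C} (f : A ⟶ B) :
    S.map f.op ≫ σ.app A = σ.app B ≫ G.map (S.map (G.map f).op) :=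
  σ.ν.naturality f.op

theorem lifting_natural_assoc {A B Z : C} (f : A ⟶ B) (h : G.obj (S.obj (op (G.obj A))) ⟶ Z) :
    S.map f.op ≫ σ.app A ≫ h = σ.app B ≫ G.map (S.map (G.map f).op) ≫ h := by
  rw [← Category.assoc, lifting_natural, Category.assoc]

theorem map_op_comp (S : Cᵒᵖ ⥤ C) {A B D : C} (f : A ⟶ B) (g : B ⟶ D) :
    S.map g.op ≫ S.map f.op = S.map (f ≫ g).op := by
  rw [op_comp, Functor.map_comp]

theorem map_map_op_comp (S : Cᵒᵖ ⥤ C) {A B D : C} (f : A ⟶ B) (g : B ⟶ D) :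
    G.map (S.map g.op) ≫ G.map (S.map f.op) = G.map (S.map (f ≫ g).op) := by
  rw [op_comp, Functor.map_comp, Functor.map_comp]

/-- The lift of a contravariant functor to coalgebras. -/
abbrev star (X : G.Coalgebra) : G.Coalgebra where
  A := S.obj (op X.A)
  a := σ.app X.A ≫ G.map (S.map X.a.op)
  counit := by
    rw [Category.assoc, map_counit, ← Category.assoc, σ.counit, map_op_comp, X.counit]
    simp
  coassoc := by
    have h := σ.comul X.A
    have h2 := congrArg (fun k => G.map k) (lifting_natural σ X.a)
    simp only [Functor.map_comp] at h2
    rw [Category.assoc, map_comul, reassoc_of% h, Category.assoc, Functor.map_comp, reassoc_of% h2,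
      ← Functor.map_comp (G.toFunctor) (G.map (S.map (G.δ.app X.A).op)),
      ← Functor.map_comp (G.toFunctor) (G.map (S.map (G.map X.a).op)), map_map_op_comp,
      map_map_op_comp, X.coassoc]

theorem IsHom.star {X Y : G.Coalgebra} {f : X.A ⟶ Y.A} (hf : IsHom X Y f) :
    IsHom (star σ Y) (star σ X) (S.map f.op) := by
  unfold IsHom at *
  dsimp only
  rw [lifting_natural_assoc, Category.assoc, map_map_op_comp, map_map_op_comp, hf]

/-- The structure of the lift of a contravariant functor, restricted along `S(ε_A)`, at the cofree
coalgebra on `A`. -/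
theorem map_counit_star (A : C) : S.map (G.ε.app A).op ≫ (star σ (cofree G A)).a = σ.app A := by
  dsimp only
  have h := lifting_natural_assoc σ (G.ε.app A) (G.map (S.map (G.δ.app A).op))
  refine h.trans ?_
  rw [map_map_op_comp, G.right_counit]
  simp

end LiftedFunctor

noncomputable section

variable {C : Type u} [Category.{v} C] [MonoidalCategory C] (𝒮 : StarAutonomous C)

local notation "S[" A "]" => CategoryTheory.Functor.obj (StarAutonomous.S 𝒮) (op A)
local notation "T[" A "]" => CategoryTheory.Functor.obj (StarAutonomous.S' 𝒮) (op A)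
local notation "P[" A "," B "]" => CategoryTheory.Functor.obj (StarAutonomous.S' 𝒮) (op (CategoryTheory.Functor.obj (StarAutonomous.S 𝒮) (op B) ⊗ CategoryTheory.Functor.obj (StarAutonomous.S 𝒮) (op A)))
local notation "Sm[" f "]" => CategoryTheory.Functor.map (StarAutonomous.S 𝒮) (Quiver.Hom.op f)
local notation "Tm[" f "]" => CategoryTheory.Functor.map (StarAutonomous.S' 𝒮) (Quiver.Hom.op f)

/-! ### Star-autonomous comonads as lifts of the star-autonomous structure -/

section StarLifts

theorem evalR_natural {A A' : C} (f : A' ⟶ A) (B : C) :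
    B ◁ Tm[f ▷ B] ≫ 𝒮.evalR B A' = 𝒮.evalR B A ≫ Tm[f] := by
  apply 𝒮.evR_ext
  rw [MonoidalCategory.whiskerLeft_comp, MonoidalCategory.whiskerLeft_comp, Category.assoc,
    Category.assoc, 𝒮.evalR_evR, 𝒮.evR_dinatural, associator_inv_naturality_right_assoc,
    𝒮.evR_dinatural, whisker_exchange_assoc, 𝒮.evalR_evR, associator_inv_naturality_left_assoc]

theorem evalR_dinatural (A : C) {B B' : C} (g : B' ⟶ B) :
    B' ◁ Tm[A ◁ g] ≫ 𝒮.evalR B' A = g ▷ T[A ⊗ B] ≫ 𝒮.evalR B A := by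
  apply 𝒮.evR_ext
  rw [MonoidalCategory.whiskerLeft_comp, MonoidalCategory.whiskerLeft_comp, Category.assoc,
    Category.assoc, 𝒮.evalR_evR, 𝒮.evalR_evR, associator_inv_naturality_right_assoc,
    𝒮.evR_dinatural, associator_inv_naturality_middle_assoc]

theorem evalL_tensor {A A' B B' : C} (f : A' ⟶ A) (g : B' ⟶ B) :
    Sm[f ⊗ₘ g] ▷ A' ≫ 𝒮.evalL A' B' = S[A ⊗ B] ◁ f ≫ 𝒮.evalL A B ≫ Sm[g] := by
  rw [MonoidalCategory.tensorHom_def, ← map_op_comp, comp_whiskerRight, Category.assoc,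
    𝒮.evalL_dinatural, ← whisker_exchange_assoc, 𝒮.evalL_natural]

theorem evalR_tensor {A A' B B' : C} (f : A' ⟶ A) (g : B' ⟶ B) :
    B' ◁ Tm[f ⊗ₘ g] ≫ 𝒮.evalR B' A' = g ▷ T[A ⊗ B] ≫ 𝒮.evalR B A ≫ Tm[f] := by
  rw [MonoidalCategory.tensorHom_def', ← map_op_comp, MonoidalCategory.whiskerLeft_comp,
    Category.assoc, evalR_dinatural, whisker_exchange_assoc, evalR_natural]

variable {G : Comonad C}

theorem tensor_map_left (φ : MonoidalComonad G) {X A B Y D : C} (f : X ⟶ G.obj A) (g : A ⟶ B)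
    (h : Y ⟶ G.obj D) :
    (f ≫ G.map g ⊗ₘ h) ≫ φ.map₂ B D = (f ⊗ₘ h) ≫ φ.map₂ A D ≫ G.map (g ▷ D) := by
  rw [← tensorHom_id, ← map₂_natural, CategoryTheory.Functor.map_id, tensorHom_comp_tensorHom_assoc,
    Category.comp_id]

theorem tensor_map_right (φ : MonoidalComonad G) {X A B Y D : C} (f : X ⟶ G.obj A) (g : A ⟶ B)
    (h : Y ⟶ G.obj D) :
    (h ⊗ₘ f ≫ G.map g) ≫ φ.map₂ D B = (h ⊗ₘ f) ≫ φ.map₂ D A ≫ G.map (D ◁ g) := by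
  rw [← id_tensorHom, ← map₂_natural, CategoryTheory.Functor.map_id, tensorHom_comp_tensorHom_assoc,
    Category.comp_id]

theorem tensor_map_left_assoc (φ : MonoidalComonad G) {X A B Y D Z : C} (f : X ⟶ G.obj A)
    (g : A ⟶ B) (h : Y ⟶ G.obj D) (k : G.obj (B ⊗ D) ⟶ Z) :
    (f ≫ G.map g ⊗ₘ h) ≫ φ.map₂ B D ≫ k =
      (f ⊗ₘ h) ≫ φ.map₂ A D ≫ G.map (g ▷ D) ≫ k := by
  rw [← Category.assoc, tensor_map_left]
  simp only [Category.assoc]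

theorem tensor_map_right_assoc (φ : MonoidalComonad G) {X A B Y D Z : C} (f : X ⟶ G.obj A)
    (g : A ⟶ B) (h : Y ⟶ G.obj D) (k : G.obj (D ⊗ B) ⟶ Z) :
    (h ⊗ₘ f ≫ G.map g) ≫ φ.map₂ D B ≫ k =
      (h ⊗ₘ f) ≫ φ.map₂ D A ≫ G.map (D ◁ g) ≫ k := by
  rw [← Category.assoc, tensor_map_right]
  simp only [Category.assoc]

/-- The star-autonomous structure of `C` lifts to `G`-coalgebras: its structure morphisms, evaluated at
coalgebras, are morphisms of coalgebras. -/
structure StarLifts (φ : MonoidalComonad G) (σ : Lifting G 𝒮.S) (σ' : Lifting G 𝒮.S') : Prop where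
  counit (X : G.Coalgebra) : IsHom X (star σ (star σ' X)) (𝒮.counit X.A)
  unit (X : G.Coalgebra) : IsHom X (star σ' (star σ X)) (𝒮.unit X.A)
  evalL (X Y : G.Coalgebra) :
    IsHom (tens φ (star σ (tens φ X Y)) X) (star σ Y) (𝒮.evalL X.A Y.A)
  evalR (X Y : G.Coalgebra) :
    IsHom (tens φ Y (star σ' (tens φ X Y))) (star σ' X) (𝒮.evalR Y.A X.A)

variable {φ : MonoidalComonad G} {σ : Lifting G 𝒮.S} {σ' : Lifting G 𝒮.S'}

/-- The structure of the lift of `S` at the tensor product of two cofree coalgebras. -/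
theorem map_counit_star_tens {S : Cᵒᵖ ⥤ C} (φ : MonoidalComonad G) (σ : Lifting G S) (A B : C) :
    S.map (G.ε.app A ⊗ₘ G.ε.app B).op ≫ (star σ (tens φ (cofree G A) (cofree G B))).a =
      σ.app (A ⊗ B) ≫ G.map (S.map (φ.map₂ A B).op) := by
  refine (lifting_natural_assoc σ (G.ε.app A ⊗ₘ G.ε.app B) _).trans ?_
  rw [map_map_op_comp, map₂_eq]
  rfl

/-- Each axiom is a lifting property at cofree coalgebras, composed with images of counits of `G`. -/
theorem StarLifts.isStarComonad (h : StarLifts 𝒮 φ σ σ') : IsStarComonad 𝒮 G φ σ σ' where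
  counit A := by
    have h1 := congrArg (fun k => k ≫ G.map (Sm[Tm[G.ε.app A]])) (h.counit (cofree G A))
    have h2 := 𝒮.counit_naturality (G.ε.app A)
    have h3 := map_counit_star σ' A
    dsimp only [Functor.id_obj] at h1 h2 h3
    simp only [Category.assoc] at h1
    rw [← Functor.map_comp, ← h2, Functor.map_comp, G.right_counit_assoc, map_map_op_comp, h3] at h1
    rw [IsIso.inv_comp_eq, h1]
  unit A := by
    have h1 := congrArg (fun k => k ≫ G.map (Tm[Sm[G.ε.app A]])) (h.unit (cofree G A))
    have h2 := 𝒮.unit_naturality (G.ε.app A)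
    have h3 := map_counit_star σ A
    dsimp only [Functor.id_obj] at h1 h2 h3
    simp only [Category.assoc] at h1
    rw [← Functor.map_comp, ← h2, Functor.map_comp, G.right_counit_assoc, map_map_op_comp, h3] at h1
    rw [IsIso.inv_comp_eq, h1]
  evalL A B := by
    have h1 : _ = _ ≫ (star σ (cofree G B)).a := h.evalL (cofree G A) (cofree G B)
    have h2 := evalL_tensor 𝒮 (G.ε.app A) (G.ε.app B)
    have h3 := map_counit_star_tens φ σ A B
    dsimp only [Functor.id_obj] at h2 h3
    rw [← map_counit_star, ← reassoc_of% h2]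
    erw [← h1]
    dsimp only
    rw [Category.assoc, ← tensorHom_id, tensorHom_comp_tensorHom_assoc, h3, Category.id_comp]
    rw [tensor_map_left_assoc]
  evalR A B := by
    have h1 : _ = _ ≫ (star σ' (cofree G A)).a := h.evalR (cofree G A) (cofree G B)
    have h2 := evalR_tensor 𝒮 (G.ε.app A) (G.ε.app B)
    have h3 := map_counit_star_tens φ σ' A B
    dsimp only [Functor.id_obj] at h2 h3
    rw [← map_counit_star, ← reassoc_of% h2]
    erw [← h1]
    dsimp only
    rw [Category.assoc, ← id_tensorHom, tensorHom_comp_tensorHom_assoc, h3, Category.id_comp]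
    rw [tensor_map_right_assoc]

/-- Each lifting property at coalgebras is an axiom composed with images of their structure
morphisms. -/
theorem StarLifts.of_isStarComonad (h : IsStarComonad 𝒮 G φ σ σ') : StarLifts 𝒮 φ σ σ' where
  counit X := by
    have h1 := h.counit X.A
    rw [IsIso.inv_comp_eq] at h1
    unfold IsHom
    dsimp only
    rw [← map_map_op_comp, ← lifting_natural_assoc, ← 𝒮.counit_naturality_assoc, h1]
  unit X := by
    have h1 := h.unit X.A
    rw [IsIso.inv_comp_eq] at h1
    unfold IsHom
    dsimp only
    rw [← map_map_op_comp, ← lifting_natural_assoc, ← reassoc_of% (𝒮.unit_naturality X.a), h1]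
  evalL X Y := by
    have h1 := h.evalL X.A Y.A
    have h2 := evalL_tensor 𝒮 X.a Y.a
    unfold IsHom
    dsimp only
    -- Insert `x ≫ ε = 1` in order to apply the axiom for `e_{A,B}`.
    have h3 : 𝒮.evalL X.A Y.A ≫ σ.app Y.A ≫ G.map Sm[Y.a] =
        S[X.A ⊗ Y.A] ◁ X.a ≫ (S[X.A ⊗ Y.A] ◁ G.ε.app X.A ≫ 𝒮.evalL X.A Y.A ≫ σ.app Y.A) ≫
          G.map Sm[Y.a] := by
      rw [Category.assoc, ← MonoidalCategory.whiskerLeft_comp_assoc, X.counit]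
      simp
    rw [h3, h1, ← id_tensorHom]
    simp only [Category.assoc]
    rw [tensorHom_comp_tensorHom_assoc, X.coassoc, Category.id_comp, tensor_map_right_assoc,
      tensor_map_left_assoc]
    simp only [← Functor.map_comp]
    rw [whisker_exchange_assoc, ← h2, ← map_op_comp, comp_whiskerRight_assoc]
  evalR X Y := by
    have h1 := h.evalR X.A Y.A
    have h2 := evalR_tensor 𝒮 X.a Y.a
    unfold IsHom
    dsimp only
    have h3 : 𝒮.evalR Y.A X.A ≫ σ'.app X.A ≫ G.map Tm[X.a] =
        Y.a ▷ T[X.A ⊗ Y.A] ≫ (G.ε.app Y.A ▷ T[X.A ⊗ Y.A] ≫ 𝒮.evalR Y.A X.A ≫ σ'.app X.A) ≫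
          G.map Tm[X.a] := by
      rw [Category.assoc, ← comp_whiskerRight_assoc, Y.counit]
      simp
    rw [h3, h1, ← tensorHom_id]
    simp only [Category.assoc]
    rw [tensorHom_comp_tensorHom_assoc, Y.coassoc, Category.id_comp, tensor_map_left_assoc,
      tensor_map_right_assoc]
    simp only [← Functor.map_comp]
    rw [← whisker_exchange_assoc, ← h2, ← map_op_comp, MonoidalCategory.whiskerLeft_comp_assoc]

end StarLifts

variable {𝒮}

/-! ### Comonads on the linearly distributive category as lifts of its structure -/

section LDLifts

variable {G : Comonad C}

/-- The morphism `ψ_{A,B} : GA ◇ GB ⟶ G(A ◇ B)`. -/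
abbrev par₂ (ψ : @MonoidalComonad C _ 𝒮.par G) (A B : C) : P[G.obj A, G.obj B] ⟶ G.obj P[A, B] :=
  @MonoidalComonad.map₂ C _ 𝒮.par G ψ A B

/-- The morphism `ψ₀ : J ⟶ GJ`. -/
abbrev par₀ (ψ : @MonoidalComonad C _ 𝒮.par G) : S[𝟙_ C] ⟶ G.obj S[𝟙_ C] :=
  @MonoidalComonad.map₀ C _ 𝒮.par G ψ

theorem par₂_natural (ψ : @MonoidalComonad C _ 𝒮.par G) {A A' B B' : C} (f : A ⟶ A')
    (g : B ⟶ B') :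
    𝒮.parMap (G.map f) (G.map g) ≫ par₂ ψ A' B' = par₂ ψ A B ≫ G.map (𝒮.parMap f g) :=
  @map₂_natural C _ G 𝒮.par ψ A A' B B' f g

theorem parMap_comp_assoc {A A' A'' B B' B'' Z : C} (f : A ⟶ A') (f' : A' ⟶ A'') (g : B ⟶ B')
    (g' : B' ⟶ B'') (h : P[A'', B''] ⟶ Z) :
    𝒮.parMap f g ≫ 𝒮.parMap f' g' ≫ h = 𝒮.parMap (f ≫ f') (g ≫ g') ≫ h := by
  rw [← Category.assoc, 𝒮.parMap_comp]

/-- The coalgebra `X ◇ Y`. -/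
abbrev parTens (ψ : @MonoidalComonad C _ 𝒮.par G) (X Y : G.Coalgebra) : G.Coalgebra where
  A := P[X.A, Y.A]
  a := 𝒮.parMap X.a Y.a ≫ par₂ ψ X.A Y.A
  counit := (@tens C _ G 𝒮.par ψ X Y).counit
  coassoc := (@tens C _ G 𝒮.par ψ X Y).coassoc

/-- The coalgebra `J`. -/
abbrev parUnit (ψ : @MonoidalComonad C _ 𝒮.par G) : G.Coalgebra where
  A := S[𝟙_ C]
  a := par₀ ψ
  counit := (@unitC C _ G 𝒮.par ψ).counit
  coassoc := (@unitC C _ G 𝒮.par ψ).coassoc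

theorem par₂_eq (ψ : @MonoidalComonad C _ 𝒮.par G) (A B : C) :
    par₂ ψ A B =
      (parTens ψ (cofree G A) (cofree G B)).a ≫ G.map (𝒮.parMap (G.ε.app A) (G.ε.app B)) :=
  @map₂_eq C _ G 𝒮.par ψ A B

variable {ψ : @MonoidalComonad C _ 𝒮.par G}

theorem IsHom.parMap {X X' Y Y' : G.Coalgebra} {f : X.A ⟶ X'.A} {g : Y.A ⟶ Y'.A}
    (hf : IsHom X X' f) (hg : IsHom Y Y' g) :
    IsHom (parTens ψ X Y) (parTens ψ X' Y') (𝒮.parMap f g) :=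
  @IsHom.tensorHom C _ G X Y 𝒮.par ψ X' Y' f g hf hg

theorem isHom_parLeftUnitor (X : G.Coalgebra) :
    IsHom (parTens ψ (parUnit ψ) X) X (𝒮.parLeftUnitor X.A).hom :=
  @isHom_leftUnitor C _ G 𝒮.par ψ X

theorem isHom_parRightUnitor (X : G.Coalgebra) :
    IsHom (parTens ψ X (parUnit ψ)) X (𝒮.parRightUnitor X.A).hom :=
  @isHom_rightUnitor C _ G 𝒮.par ψ X

/-- The structure of a linearly distributive category with negations of `C` lifts to
`G`-coalgebras: its structure morphisms, evaluated at coalgebras, are morphisms of coalgebras. -/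
structure LDLifts (φ : MonoidalComonad G) (ψ : @MonoidalComonad C _ 𝒮.par G) (σ : Lifting G 𝒮.S)
    (σ' : Lifting G 𝒮.S') : Prop where
  distL (X Y Z : G.Coalgebra) :
    IsHom (tens φ X (parTens ψ Y Z)) (parTens ψ (tens φ X Y) Z) (𝒮.distL X.A Y.A Z.A)
  distR (X Y Z : G.Coalgebra) :
    IsHom (tens φ (parTens ψ Y Z) X) (parTens ψ Y (tens φ Z X)) (𝒮.distR Y.A Z.A X.A)
  ev (X : G.Coalgebra) : IsHom (tens φ (star σ X) X) (parUnit ψ) (𝒮.ev X.A)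
  coev (X : G.Coalgebra) : IsHom (unitC φ) (parTens ψ X (star σ X)) (𝒮.coev X.A)
  ev' (X : G.Coalgebra) : IsHom (tens φ X (star σ' X)) (parUnit ψ) (𝒮.ev' X.A)
  coev' (X : G.Coalgebra) : IsHom (unitC φ) (parTens ψ (star σ' X) X) (𝒮.coev' X.A)

variable {φ : MonoidalComonad G} {σ : Lifting G 𝒮.S} {σ' : Lifting G 𝒮.S'}

/-- Each axiom is a lifting property at cofree coalgebras, composed with images of counits of `G`. -/
theorem LDLifts.isLDComonad (h : LDLifts φ ψ σ σ') : IsLDComonad 𝒮.toLDNeg G φ ψ σ σ' where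
  distL A B D := by
    have h1 : _ = _ ≫ _ := h.distL (cofree G A) (cofree G B) (cofree G D)
    have h2 := 𝒮.distL_nat (G.ε.app A) (G.ε.app B) (G.ε.app D)
    have h3 := par₂_eq ψ B D
    have h4 := map₂_eq (φ := φ) A B
    have h5 := map₂_natural φ (G.ε.app A) (𝒮.parMap (G.ε.app B) (G.ε.app D))
    have h6 := par₂_natural ψ (G.ε.app A ⊗ₘ G.ε.app B) (G.ε.app D)
    change G.obj A ◁ par₂ ψ B D ≫ φ.map₂ A P[B, D] ≫ G.map (𝒮.distL A B D) =
      𝒮.distL (G.obj A) (G.obj B) (G.obj D) ≫ 𝒮.parMap (φ.map₂ A B) (𝟙 (G.obj D)) ≫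
        par₂ ψ (A ⊗ B) D
    dsimp only [Functor.id_obj] at h1 h2 h3 h4 h5 h6
    rw [h3, h4, ← id_tensorHom, ← G.right_counit A, ← G.right_counit D,
      ← tensorHom_comp_tensorHom_assoc, reassoc_of% h5, ← Functor.map_comp, h2, ← 𝒮.parMap_comp,
      Category.assoc, h6, Functor.map_comp, ← Category.assoc (φ.map₂ _ _), ← Category.assoc (_ ⊗ₘ _),
      ← Category.assoc (_ ⊗ₘ _), h1]
    simp only [Category.assoc]
  distR A B D := by
    have h1 : _ = _ ≫ _ := h.distR (cofree G A) (cofree G B) (cofree G D)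
    have h2 := 𝒮.distR_nat (G.ε.app B) (G.ε.app D) (G.ε.app A)
    have h3 := par₂_eq ψ B D
    have h4 := map₂_eq (φ := φ) D A
    have h5 := map₂_natural φ (𝒮.parMap (G.ε.app B) (G.ε.app D)) (G.ε.app A)
    have h6 := par₂_natural ψ (G.ε.app B) (G.ε.app D ⊗ₘ G.ε.app A)
    change par₂ ψ B D ▷ G.obj A ≫ φ.map₂ P[B, D] A ≫ G.map (𝒮.distR B D A) =
      𝒮.distR (G.obj B) (G.obj D) (G.obj A) ≫ 𝒮.parMap (𝟙 (G.obj B)) (φ.map₂ D A) ≫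
        par₂ ψ B (D ⊗ A)
    dsimp only [Functor.id_obj] at h1 h2 h3 h4 h5 h6
    rw [h3, h4, ← tensorHom_id, ← G.right_counit A, ← G.right_counit B,
      ← tensorHom_comp_tensorHom_assoc, reassoc_of% h5, ← Functor.map_comp, h2, ← 𝒮.parMap_comp,
      Category.assoc, h6, Functor.map_comp, ← Category.assoc (φ.map₂ _ _), ← Category.assoc (_ ⊗ₘ _),
      ← Category.assoc (_ ⊗ₘ _), h1]
    simp only [Category.assoc]
  ev A := by
    have h1 : _ = _ ≫ _ := h.ev (cofree G A)
    have h2 := 𝒮.ev_dinatural (G.ε.app A)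
    have h3 := map_counit_star σ A
    change S[A] ◁ G.ε.app A ≫ 𝒮.ev A ≫ par₀ ψ = (σ.app A ⊗ₘ G.δ.app A) ≫
      φ.map₂ S[G.obj A] (G.obj A) ≫ G.map (𝒮.ev (G.obj A))
    dsimp only [Functor.id_obj] at h1 h2 h3
    rw [← reassoc_of% h2, ← h1, ← h3, ← tensorHom_id, Category.assoc,
      tensorHom_comp_tensorHom_assoc, Category.id_comp]
  coev A := by
    have h1 : _ = _ ≫ _ := h.coev (cofree G A)
    have h2 := 𝒮.coev_dinatural (G.ε.app A)
    have h3 := par₂_natural ψ (G.ε.app A) (𝟙 S[G.obj A])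
    have h4 := par₂_natural ψ (𝟙 A) Sm[G.δ.app A]
    change φ.map₀ ≫ G.map (𝒮.coev A) ≫ G.map (𝒮.parMap (𝟙 A) Sm[G.ε.app A]) =
      𝒮.coev (G.obj A) ≫ 𝒮.parMap (𝟙 (G.obj A)) (σ.app (G.obj A)) ≫
        par₂ ψ A S[G.obj (G.obj A)] ≫ G.map (𝒮.parMap (𝟙 A) Sm[G.δ.app A])
    dsimp only [Functor.id_obj, Functor.comp_obj] at h1 h2 h3 h4
    rw [← Functor.map_comp, ← h2, Functor.map_comp, reassoc_of% h1, ← h3, ← h4,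
      parMap_comp_assoc, parMap_comp_assoc, G.right_counit]
    simp
  ev' A := by
    have h1 : _ = _ ≫ _ := h.ev' (cofree G A)
    have h2 := 𝒮.ev'_dinatural (G.ε.app A)
    have h3 := map_counit_star σ' A
    change G.ε.app A ▷ T[A] ≫ 𝒮.ev' A ≫ par₀ ψ = (G.δ.app A ⊗ₘ σ'.app A) ≫
      φ.map₂ (G.obj A) T[G.obj A] ≫ G.map (𝒮.ev' (G.obj A))
    dsimp only [Functor.id_obj] at h1 h2 h3
    rw [← reassoc_of% h2, ← h1, ← h3, ← id_tensorHom, Category.assoc,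
      tensorHom_comp_tensorHom_assoc, Category.id_comp]
  coev' A := by
    have h1 : _ = _ ≫ _ := h.coev' (cofree G A)
    have h2 := 𝒮.coev'_dinatural (G.ε.app A)
    have h3 := par₂_natural ψ (𝟙 T[G.obj A]) (G.ε.app A)
    have h4 := par₂_natural ψ Tm[G.δ.app A] (𝟙 A)
    change φ.map₀ ≫ G.map (𝒮.coev' A) ≫ G.map (𝒮.parMap Tm[G.ε.app A] (𝟙 A)) =
      𝒮.coev' (G.obj A) ≫ 𝒮.parMap (σ'.app (G.obj A)) (𝟙 (G.obj A)) ≫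
        par₂ ψ T[G.obj (G.obj A)] A ≫ G.map (𝒮.parMap Tm[G.δ.app A] (𝟙 A))
    dsimp only [Functor.id_obj, Functor.comp_obj] at h1 h2 h3 h4
    rw [← Functor.map_comp, ← h2, Functor.map_comp, reassoc_of% h1, ← h3, ← h4,
      parMap_comp_assoc, parMap_comp_assoc, G.right_counit]
    simp

/-- Each lifting property at coalgebras is an axiom composed with images of their structure
morphisms. -/
theorem LDLifts.of_isLDComonad (h : IsLDComonad 𝒮.toLDNeg G φ ψ σ σ') : LDLifts φ ψ σ σ' where
  distL X Y Z := by
    have h1 : G.obj X.A ◁ par₂ ψ Y.A Z.A ≫ φ.map₂ X.A P[Y.A, Z.A] ≫ G.map (𝒮.distL X.A Y.A Z.A) =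
      𝒮.distL (G.obj X.A) (G.obj Y.A) (G.obj Z.A) ≫ 𝒮.parMap (φ.map₂ X.A Y.A) (𝟙 (G.obj Z.A)) ≫
        par₂ ψ (X.A ⊗ Y.A) Z.A := h.distL X.A Y.A Z.A
    unfold IsHom
    dsimp only
    rw [← Category.comp_id X.a, ← tensorHom_comp_tensorHom_assoc, Category.assoc,
      Category.assoc, id_tensorHom, h1,
      reassoc_of% (𝒮.distL_nat X.a Y.a Z.a), parMap_comp_assoc, Category.comp_id, Category.comp_id]
  distR X Y Z := by
    have h1 : par₂ ψ Y.A Z.A ▷ G.obj X.A ≫ φ.map₂ P[Y.A, Z.A] X.A ≫ G.map (𝒮.distR Y.A Z.A X.A) =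
      𝒮.distR (G.obj Y.A) (G.obj Z.A) (G.obj X.A) ≫ 𝒮.parMap (𝟙 (G.obj Y.A)) (φ.map₂ Z.A X.A) ≫
        par₂ ψ Y.A (Z.A ⊗ X.A) := h.distR X.A Y.A Z.A
    unfold IsHom
    dsimp only
    rw [← Category.comp_id X.a, ← tensorHom_comp_tensorHom_assoc, Category.assoc,
      Category.assoc, tensorHom_id, h1,
      reassoc_of% (𝒮.distR_nat Y.a Z.a X.a), parMap_comp_assoc, Category.comp_id, Category.comp_id]
  ev X := by
    have h1 : S[X.A] ◁ G.ε.app X.A ≫ 𝒮.ev X.A ≫ par₀ ψ = (σ.app X.A ⊗ₘ G.δ.app X.A) ≫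
      φ.map₂ S[G.obj X.A] (G.obj X.A) ≫ G.map (𝒮.ev (G.obj X.A)) := h.ev X.A
    have h2 := congrArg (fun k => S[X.A] ◁ X.a ≫ k) h1
    rw [← MonoidalCategory.whiskerLeft_comp_assoc, X.counit, MonoidalCategory.whiskerLeft_id,
      Category.id_comp, ← id_tensorHom, tensorHom_comp_tensorHom_assoc, X.coassoc,
      tensor_map_right_assoc, ← Functor.map_comp, ← 𝒮.ev_dinatural X.a, Category.id_comp,
      Functor.map_comp, ← tensor_map_left_assoc] at h2
    unfold IsHom
    dsimp only
    rw [h2, Category.assoc]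
  coev X := by
    have h1 : φ.map₀ ≫ G.map (𝒮.coev X.A) ≫ G.map (𝒮.parMap (𝟙 X.A) Sm[G.ε.app X.A]) =
      𝒮.coev (G.obj X.A) ≫ 𝒮.parMap (𝟙 (G.obj X.A)) (σ.app (G.obj X.A)) ≫
        par₂ ψ X.A S[G.obj (G.obj X.A)] ≫ G.map (𝒮.parMap (𝟙 X.A) Sm[G.δ.app X.A]) := h.coev X.A
    have h2 := congrArg (fun k => k ≫ G.map (𝒮.parMap (𝟙 X.A) Sm[X.a])) h1
    simp only [Category.assoc] at h2
    rw [← Functor.map_comp, ← Functor.map_comp, ← Functor.map_comp, 𝒮.parMap_comp,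
      𝒮.parMap_comp, Category.comp_id (𝟙 X.A), map_op_comp,
      map_op_comp, X.counit, X.coassoc, ← map_op_comp, ← par₂_natural, parMap_comp_assoc,
      CategoryTheory.Functor.map_id, Category.id_comp, Functor.map_comp, Functor.map_comp,
      ← lifting_natural_assoc] at h2
    -- Dinaturality of `n` turns `S(x)` in the second argument into `x` in the first one.
    have h3 : 𝒮.coev (G.obj X.A) ≫ 𝒮.parMap (𝟙 _)
          (Sm[X.a] ≫ σ.app X.A ≫ G.map Sm[X.a]) =
        𝒮.coev X.A ≫ 𝒮.parMap X.a (σ.app X.A ≫ G.map Sm[X.a]) := by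
      have h4 := congrArg (fun k => k ≫ 𝒮.parMap (𝟙 _) (σ.app X.A ≫ G.map Sm[X.a]))
        (𝒮.coev_dinatural X.a)
      simp only [Category.assoc, 𝒮.parMap_comp, Category.comp_id, Category.id_comp] at h4
      simpa using h4.symm
    rw [reassoc_of% h3] at h2
    simpa [IsHom] using h2
  ev' X := by
    have h1 : G.ε.app X.A ▷ T[X.A] ≫ 𝒮.ev' X.A ≫ par₀ ψ = (G.δ.app X.A ⊗ₘ σ'.app X.A) ≫
      φ.map₂ (G.obj X.A) T[G.obj X.A] ≫ G.map (𝒮.ev' (G.obj X.A)) := h.ev' X.A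
    have h2 := congrArg (fun k => X.a ▷ T[X.A] ≫ k) h1
    rw [← comp_whiskerRight_assoc, X.counit, id_whiskerRight,
      Category.id_comp, ← tensorHom_id, tensorHom_comp_tensorHom_assoc, X.coassoc,
      tensor_map_left_assoc, ← Functor.map_comp, ← 𝒮.ev'_dinatural X.a, Category.id_comp,
      Functor.map_comp, ← tensor_map_right_assoc] at h2
    unfold IsHom
    dsimp only
    rw [h2, Category.assoc]
  coev' X := by
    have h1 : φ.map₀ ≫ G.map (𝒮.coev' X.A) ≫ G.map (𝒮.parMap Tm[G.ε.app X.A] (𝟙 X.A)) =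
      𝒮.coev' (G.obj X.A) ≫ 𝒮.parMap (σ'.app (G.obj X.A)) (𝟙 (G.obj X.A)) ≫
        par₂ ψ T[G.obj (G.obj X.A)] X.A ≫ G.map (𝒮.parMap Tm[G.δ.app X.A] (𝟙 X.A)) := h.coev' X.A
    have h2 := congrArg (fun k => k ≫ G.map (𝒮.parMap Tm[X.a] (𝟙 X.A))) h1
    simp only [Category.assoc] at h2
    rw [← Functor.map_comp, ← Functor.map_comp, ← Functor.map_comp, 𝒮.parMap_comp,
      𝒮.parMap_comp, Category.comp_id (𝟙 X.A), map_op_comp,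
      map_op_comp, X.counit, X.coassoc, ← map_op_comp, ← par₂_natural, parMap_comp_assoc,
      CategoryTheory.Functor.map_id, Category.id_comp, Functor.map_comp, Functor.map_comp,
      ← lifting_natural_assoc] at h2
    have h3 : 𝒮.coev' (G.obj X.A) ≫ 𝒮.parMap (Tm[X.a] ≫ σ'.app X.A ≫ G.map Tm[X.a])
          (𝟙 _) =
        𝒮.coev' X.A ≫ 𝒮.parMap (σ'.app X.A ≫ G.map Tm[X.a]) X.a := by
      have h4 := congrArg (fun k => k ≫ 𝒮.parMap (σ'.app X.A ≫ G.map Tm[X.a]) (𝟙 _))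
        (𝒮.coev'_dinatural X.a)
      simp only [Category.assoc, 𝒮.parMap_comp, Category.comp_id, Category.id_comp] at h4
      simpa using h4.symm
    rw [reassoc_of% h3] at h2
    simpa [IsHom] using h2

end LDLifts

/-! ### From the linearly distributive structure to the star-autonomous structure -/

section

/-- The transpose of a pairing in terms of the linearly distributive structure. -/
theorem lift_eq {X A : C} (f : X ⊗ A ⟶ S[𝟙_ C]) :
    𝒮.lift f = (ρ_ X).inv ≫ X ◁ 𝒮.coev A ≫ 𝒮.distL X A S[A] ≫ 𝒮.parMap f (𝟙 S[A]) ≫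
      (𝒮.parLeftUnitor S[A]).hom := by
  rw [𝒮.parLeftUnitor_distL, 𝒮.coev_ev]
  simp

theorem lift'_eq {X A : C} (f : A ⊗ X ⟶ S[𝟙_ C]) :
    𝒮.lift' f = (λ_ X).inv ≫ 𝒮.coev' A ▷ X ≫ 𝒮.distR T[A] A X ≫ 𝒮.parMap (𝟙 T[A]) f ≫
      (𝒮.parRightUnitor T[A]).hom := by
  apply 𝒮.ev_ext'
  simp only [MonoidalCategory.whiskerLeft_comp, Category.assoc]
  rw [𝒮.parRightUnitor_ev, 𝒮.parEv_whiskerLeft, 𝒮.distR_ev_assoc,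
    associator_inv_naturality_middle_assoc, ← comp_whiskerRight_assoc, 𝒮.coev'_ev,
    ← 𝒮.inv_counit_evR, whisker_exchange_assoc, 𝒮.lift'_evR]
  simp [-op_tensorObj, -op_tensorUnit]

theorem lift'_ev (A : C) : 𝒮.lift' (𝒮.ev A) = 𝒮.unit A := by
  apply 𝒮.evR_ext
  rw [𝒮.lift'_evR, 𝒮.unit_evR]

theorem lift_evalL (A B : C) :
    𝒮.lift ((α_ _ _ _).hom ≫ 𝒮.ev (A ⊗ B)) = 𝒮.evalL A B := by
  apply 𝒮.ev_ext
  rw [𝒮.lift_ev, 𝒮.evalL_ev]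

theorem lift'_evalR (A B : C) :
    𝒮.lift' ((α_ _ _ _).inv ≫ 𝒮.ev' (A ⊗ B)) = 𝒮.evalR B A := by
  apply 𝒮.evR_ext
  rw [𝒮.lift'_evR, 𝒮.evalR_evR, 𝒮.ev'_eq]

theorem parEv_eq (A B : C) :
    𝒮.parEv A B = 𝒮.distL S[A] A B ≫ 𝒮.parMap (𝒮.ev A) (𝟙 B) ≫ (𝒮.parLeftUnitor B).hom := by
  have h := 𝒮.parLeftUnitor_distL (𝟙 P[A, B]) (𝒮.ev A)
  rw [𝒮.lift_ev_self] at h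
  simpa using h.symm

/-- One triangle identity of the adjunction between `SA ⊗ -` and `A ◇ -`. -/
theorem coev_parEv (A B : C) :
    (λ_ P[A, B]).inv ≫ 𝒮.coev A ▷ P[A, B] ≫ 𝒮.distR A S[A] P[A, B] ≫
      𝒮.parMap (𝟙 A) (𝒮.parEv A B) = 𝟙 P[A, B] := by
  apply 𝒮.parEv_ext
  simp only [MonoidalCategory.whiskerLeft_comp, Category.assoc]
  rw [𝒮.parEv_whiskerLeft, 𝒮.distR_ev_assoc,
    associator_inv_naturality_middle_assoc, ← comp_whiskerRight_assoc, 𝒮.coev_ev]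
  simp [-op_tensorObj, -op_tensorUnit]

variable {G : Comonad C} {φ : MonoidalComonad G} {σ : Lifting G 𝒮.S} {σ' : Lifting G 𝒮.S'}

section LD

variable {ψ : @MonoidalComonad C _ 𝒮.par G} (h : LDLifts φ ψ σ σ')
include h

theorem LDLifts.lift {X Y : G.Coalgebra} {f : X.A ⊗ Y.A ⟶ S[𝟙_ C]}
    (hf : IsHom (tens φ X Y) (parUnit ψ) f) : IsHom X (star σ Y) (𝒮.lift f) := by
  rw [lift_eq]
  exact (isHom_rightUnitor_inv X).comp <| ((h.coev Y).whiskerLeft X).comp <|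
    (h.distL X Y (star σ Y)).comp <| (hf.parMap (IsHom.id (star σ Y))).comp <|
    isHom_parLeftUnitor (star σ Y)

theorem LDLifts.lift' {X Y : G.Coalgebra} {f : Y.A ⊗ X.A ⟶ S[𝟙_ C]}
    (hf : IsHom (tens φ Y X) (parUnit ψ) f) : IsHom X (star σ' Y) (𝒮.lift' f) := by
  rw [lift'_eq]
  exact (isHom_leftUnitor_inv X).comp <| ((h.coev' Y).whiskerRight X).comp <|
    (h.distR X (star σ' Y) Y).comp <| ((IsHom.id (star σ' Y)).parMap hf).comp <|
    isHom_parRightUnitor (star σ' Y)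

theorem LDLifts.starLifts : StarLifts 𝒮 φ σ σ' where
  counit X := by
    rw [← 𝒮.lift_ev'_self]
    exact h.lift (X := X) (Y := star σ' X) (h.ev' X)
  unit X := by
    rw [← lift'_ev]
    exact h.lift' (X := X) (Y := star σ X) (h.ev X)
  evalL X Y := by
    rw [← lift_evalL]
    exact h.lift (X := tens φ (star σ (tens φ X Y)) X) (Y := Y)
      ((isHom_associator (star σ (tens φ X Y)) X Y).comp (h.ev (tens φ X Y)))
  evalR X Y := by
    rw [← lift'_evalR]
    exact h.lift' (X := tens φ Y (star σ' (tens φ X Y))) (Y := X)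
      ((isHom_associator_inv X Y (star σ' (tens φ X Y))).comp (h.ev' (tens φ X Y)))

theorem LDLifts.parEv (X Y : G.Coalgebra) :
    IsHom (tens φ (star σ X) (parTens ψ X Y)) Y (𝒮.parEv X.A Y.A) := by
  rw [parEv_eq]
  exact (h.distL (star σ X) X Y).comp <| ((h.ev X).parMap (IsHom.id Y)).comp <|
    isHom_parLeftUnitor Y

/-- By `coev_parEv`, the identity is a morphism of coalgebras between any two lifts of `A ◇ B`. -/
theorem LDLifts.isHom_id {ψ' : @MonoidalComonad C _ 𝒮.par G} (h' : LDLifts φ ψ' σ σ')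
    (X Y : G.Coalgebra) : IsHom (parTens ψ X Y) (parTens ψ' X Y) (𝟙 P[X.A, Y.A]) := by
  rw [← coev_parEv]
  exact (isHom_leftUnitor_inv (parTens ψ X Y)).comp <|
    ((h'.coev X).whiskerRight (parTens ψ X Y)).comp <|
    (h'.distR (parTens ψ X Y) X (star σ X)).comp <| (IsHom.id X).parMap (h.parEv X Y)

/-- Two monoidal comonad structures agree as soon as they give the same coalgebra structures on `J` and
on the `◇` of cofree coalgebras. -/
theorem LDLifts.unique {ψ' : @MonoidalComonad C _ 𝒮.par G} (h' : LDLifts φ ψ' σ σ') :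
    ψ = ψ' := by
  apply @MonoidalComonad.ext' C _ G 𝒮.par
  · have h1 : _ = _ ≫ par₀ ψ := h.ev (unitC φ)
    have h2 : _ = _ ≫ par₀ ψ' := h'.ev (unitC φ)
    -- `e_I` is the right unit isomorphism, so that it can be cancelled.
    have : IsIso (𝒮.ev (unitC φ).A) := by
      dsimp only
      rw [𝒮.ev_unit]
      infer_instance
    rw [← cancel_epi (𝒮.ev (unitC φ).A)]
    exact h1.symm.trans h2
  · intro A B
    have h1 := h.isHom_id h' (cofree G A) (cofree G B)
    have h2 : (parTens ψ (cofree G A) (cofree G B)).a =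
        (parTens ψ' (cofree G A) (cofree G B)).a := by
      simpa only [IsHom, CategoryTheory.Functor.map_id, Category.comp_id, Category.id_comp] using h1
    exact (par₂_eq ψ A B).trans ((congrArg (fun k => k ≫ _) h2).trans (par₂_eq ψ' A B).symm)

end LD

end

/-! ### From the star-autonomous structure to the linearly distributive structure -/

section

/-- The bijection `τ` is determined by `e'` and the isomorphisms of the equivalence. -/
theorem tau_eq {A B D : C} (f : A ⊗ B ⟶ S[D]) :
    𝒮.τ A B D f = 𝒮.counit A ≫ Sm[𝒮.evalR B A] ≫ Sm[B ◁ (𝒮.unit D ≫ Tm[f])] := by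
  have h := 𝒮.τ_naturality (𝟙 A) (𝟙 B) (𝒮.unit D ≫ Tm[f]) (𝒮.counit (A ⊗ B))
  rw [id_tensorHom_id, Category.id_comp, Category.id_comp, id_tensorHom, ← map_op_comp,
    ← 𝒮.counit_naturality_assoc, 𝒮.counit_map_unit, Category.comp_id, ← 𝒮.counit_evalR,
    Category.assoc] at h
  exact h

variable {G : Comonad C} {φ : MonoidalComonad G} {σ : Lifting G 𝒮.S} {σ' : Lifting G 𝒮.S'}

namespace StarLifts

variable (h : StarLifts 𝒮 φ σ σ')
include h

theorem unit_inv (X : G.Coalgebra) : IsHom (star σ' (star σ X)) X (inv (𝒮.unit X.A)) :=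
  IsHom.isIso_inv (X := X) (Y := star σ' (star σ X)) (h.unit X)

theorem counitIso_inv (X : G.Coalgebra) :
    IsHom (star σ (star σ' X)) X (𝒮.counitIso X.A).inv :=
  IsHom.iso_inv (X := X) (Y := star σ (star σ' X)) (h.counit X)

theorem unitIso_inv (X : G.Coalgebra) : IsHom (star σ' (star σ X)) X (𝒮.unitIso X.A).inv :=
  IsHom.iso_inv (X := X) (Y := star σ' (star σ X)) (h.unit X)

theorem counit_inv (X : G.Coalgebra) : IsHom (star σ (star σ' X)) X (inv (𝒮.counit X.A)) :=
  IsHom.isIso_inv (X := X) (Y := star σ (star σ' X)) (h.counit X)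

theorem tau {X Y Z : G.Coalgebra} {f : X.A ⊗ Y.A ⟶ S[Z.A]}
    (hf : IsHom (tens φ X Y) (star σ Z) f) :
    IsHom X (star σ (tens φ Y Z)) (𝒮.τ X.A Y.A Z.A f) := by
  rw [tau_eq]
  exact (h.counit X).comp <| ((h.evalR X Y).star σ).comp <|
    (((h.unit Z).comp (hf.star σ')).whiskerLeft Y).star σ

theorem lift {X Y : G.Coalgebra} {f : X.A ⊗ Y.A ⟶ S[𝟙_ C]}
    (hf : IsHom (tens φ X Y) (star σ (unitC φ)) f) : IsHom X (star σ Y) (𝒮.lift f) :=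
  (h.tau (Z := unitC φ) hf).comp ((isHom_rightUnitor_inv Y).star σ)

theorem lift' {X Y : G.Coalgebra} {f : Y.A ⊗ X.A ⟶ S[𝟙_ C]}
    (hf : IsHom (tens φ Y X) (star σ (unitC φ)) f) : IsHom X (star σ' Y) (𝒮.lift' f) :=
  (h.unit X).comp ((h.lift hf).star σ')

theorem ev (X : G.Coalgebra) :
    IsHom (tens φ (star σ X) X) (star σ (unitC φ)) (𝒮.ev X.A) :=
  (((isHom_rightUnitor X).star σ).whiskerRight X).comp (h.evalL X (unitC φ))

theorem ev' (X : G.Coalgebra) :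
    IsHom (tens φ X (star σ' X)) (star σ (unitC φ)) (𝒮.ev' X.A) := by
  rw [𝒮.ev'_eq]
  exact ((h.counit X).whiskerRight (star σ' X)).comp (h.ev (star σ' X))

theorem kappa : IsHom (star σ (unitC φ)) (star σ' (unitC φ)) 𝒮.kappa.hom :=
  h.lift' (X := star σ (unitC φ)) (Y := unitC φ) (isHom_leftUnitor (star σ (unitC φ)))

theorem unitDual : IsHom (unitC φ) (star σ (star σ (unitC φ))) 𝒮.unitDual.hom :=
  (h.counit (unitC φ)).comp (h.kappa.star σ)

omit h in
/-- The lift of `A ◇ B = S'(SB ⊗ SA)` to coalgebras obtained from the lifts of `⊗`, `S` and `S'`. -/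
abbrev parStar (φ : MonoidalComonad G) (σ : Lifting G 𝒮.S) (σ' : Lifting G 𝒮.S')
    (X Y : G.Coalgebra) : G.Coalgebra :=
  star σ' (tens φ (star σ Y) (star σ X))

omit h in
theorem parMap {X X' Y Y' : G.Coalgebra} {f : X.A ⟶ X'.A} {g : Y.A ⟶ Y'.A}
    (hf : IsHom X X' f) (hg : IsHom Y Y' g) :
    IsHom (parStar φ σ σ' X Y) (parStar φ σ σ' X' Y') (𝒮.parMap f g) :=
  ((hg.star σ).tensorHom (hf.star σ)).star σ'

theorem parAssoc (X Y Z : G.Coalgebra) :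
    IsHom (parStar φ σ σ' (parStar φ σ σ' X Y) Z) (parStar φ σ σ' X (parStar φ σ σ' Y Z))
      (𝒮.parAssoc X.A Y.A Z.A).hom := by
  rw [𝒮.parAssoc_hom]
  exact ((((h.counitIso_inv (tens φ (star σ Z) (star σ Y))).whiskerRight (star σ X)).comp <|
    (isHom_associator (star σ Z) (star σ Y) (star σ X)).comp <|
    (h.counit (tens φ (star σ Y) (star σ X))).whiskerLeft (star σ Z))).star σ'

theorem parLeftUnitor (X : G.Coalgebra) :
    IsHom (parStar φ σ σ' (star σ (unitC φ)) X) X (𝒮.parLeftUnitor X.A).hom := by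
  rw [𝒮.parLeftUnitor_hom]
  exact (((isHom_rightUnitor_inv (star σ X)).comp
    (h.unitDual.whiskerLeft (star σ X))).star σ').comp (h.unitIso_inv X)

theorem parRightUnitor (X : G.Coalgebra) :
    IsHom (parStar φ σ σ' X (star σ (unitC φ))) X (𝒮.parRightUnitor X.A).hom := by
  rw [𝒮.parRightUnitor_hom]
  exact (((isHom_leftUnitor_inv (star σ X)).comp
    (h.unitDual.whiskerRight (star σ X))).star σ').comp (h.unitIso_inv X)

theorem parEv (X Y : G.Coalgebra) :
    IsHom (tens φ (star σ X) (parStar φ σ σ' X Y)) Y (𝒮.parEv X.A Y.A) :=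
  (h.evalR (star σ Y) (star σ X)).comp (h.unit_inv Y)

theorem parEv' (X Y : G.Coalgebra) :
    IsHom (tens φ (parStar φ σ σ' X Y) (star σ' Y)) X (𝒮.parEv' X.A Y.A) :=
  (h.unit (tens φ (parStar φ σ σ' X Y) (star σ' Y))).comp <|
    ((h.tau (X := star σ X) (Y := parStar φ σ σ' X Y) (Z := star σ' Y)
      ((h.parEv X Y).comp (h.counit Y))).star σ').comp (h.unit_inv X)

theorem parIso (X Y : G.Coalgebra) :
    IsHom (parStar φ σ σ' X Y) (star σ (tens φ (star σ' Y) (star σ' X)))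
      (𝒮.parIso X.A Y.A).hom :=
  h.tau (X := parStar φ σ σ' X Y) (Y := star σ' Y) (Z := star σ' X)
    ((h.parEv' X Y).comp (h.counit X))

theorem parIso_inv (X Y : G.Coalgebra) :
    IsHom (star σ (tens φ (star σ' Y) (star σ' X))) (parStar φ σ σ' X Y)
      (𝒮.parIso X.A Y.A).inv :=
  IsHom.iso_inv (X := parStar φ σ σ' X Y) (h.parIso X Y)

theorem distL (X Y Z : G.Coalgebra) :
    IsHom (tens φ X (parStar φ σ σ' Y Z)) (parStar φ σ σ' (tens φ X Y) Z)
      (𝒮.distL X.A Y.A Z.A) :=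
  ((((isHom_associator (star σ Z) (star σ (tens φ X Y)) X).comp
    ((h.evalL X Y).whiskerLeft (star σ Z))).star σ').whiskerLeft X).comp
    (h.evalR (tens φ (star σ Z) (star σ (tens φ X Y))) X)

theorem distR (X Y Z : G.Coalgebra) :
    IsHom (tens φ (parStar φ σ σ' Y Z) X) (parStar φ σ σ' Y (tens φ Z X))
      (𝒮.distR Y.A Z.A X.A) :=
  ((h.parIso Y Z).whiskerRight X).comp <|
    ((((isHom_associator_inv X (star σ' (tens φ Z X)) (star σ' Y)).comp
      ((h.evalR Z X).whiskerRight (star σ' Y))).star σ).whiskerRight X).comp <|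
    (h.evalL X (tens φ (star σ' (tens φ Z X)) (star σ' Y))).comp (h.parIso_inv Y (tens φ Z X))

theorem coev (X : G.Coalgebra) :
    IsHom (unitC φ) (parStar φ σ σ' X (star σ X)) (𝒮.coev X.A) :=
  (h.counit (unitC φ)).comp <|
    ((((h.unit_inv X).whiskerRight (star σ' X)).comp <|
      (((isHom_leftUnitor X).star σ').whiskerLeft X).comp (h.evalR (unitC φ) X)).star σ).comp
    (h.parIso_inv X (star σ X))

theorem coev' (X : G.Coalgebra) :
    IsHom (unitC φ) (parStar φ σ σ' (star σ' X) X) (𝒮.coev' X.A) :=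
  (h.unit (unitC φ)).comp
    ((((h.counit_inv X).whiskerLeft (star σ X)).comp (h.ev X)).star σ')

/-- The lift of the monoidal structure `(◇, J)` to coalgebras. -/
def tensorLift : @TensorLift C _ G 𝒮.par :=
  @TensorLift.mk C _ G 𝒮.par
    (a := fun X Y => (parStar φ σ σ' X Y).a)
    (a₀ := (star σ (unitC φ)).a)
    (counit := fun X Y => (parStar φ σ σ' X Y).counit)
    (coassoc := fun X Y => (parStar φ σ σ' X Y).coassoc)
    (counit₀ := (star σ (unitC φ)).counit)
    (coassoc₀ := (star σ (unitC φ)).coassoc)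
    (tensorHom := fun hf hg => parMap (σ' := σ') hf hg)
    (associator := h.parAssoc)
    (leftUnitor := h.parLeftUnitor)
    (rightUnitor := h.parRightUnitor)

/-- The monoidal comonad structure on `G` with respect to `(◇, J)`. -/
def parMonoidalComonad : @MonoidalComonad C _ 𝒮.par G :=
  @TensorLift.monoidalComonad C _ G 𝒮.par h.tensorLift

theorem parTens_structure (X Y : G.Coalgebra) :
    𝒮.parMap X.a Y.a ≫ par₂ h.parMonoidalComonad X.A Y.A = (parStar φ σ σ' X Y).a :=
  @TensorLift.structure_monoidalComonad C _ G 𝒮.par h.tensorLift X Y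

theorem ldLifts : LDLifts φ h.parMonoidalComonad σ σ' where
  distL X Y Z := by
    unfold IsHom
    dsimp only
    rw [h.parTens_structure Y Z, h.parTens_structure (tens φ X Y) Z]
    exact h.distL X Y Z
  distR X Y Z := by
    unfold IsHom
    dsimp only
    rw [h.parTens_structure Y Z, h.parTens_structure Y (tens φ Z X)]
    exact h.distR X Y Z
  ev := h.ev
  coev X := by
    unfold IsHom
    dsimp only
    rw [h.parTens_structure X (star σ X)]
    exact h.coev X
  ev' := h.ev'
  coev' X := by
    unfold IsHom
    dsimp only
    rw [h.parTens_structure (star σ' X) X]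
    exact h.coev' X

end StarLifts

end

end

end StarComonad

theorem mainTheorem1 {C : Type u} [Category.{v} C] [MonoidalCategory C] (𝒮 : StarAutonomous C)
    (G : Comonad C) (φ : MonoidalComonad G) (σ : Lifting G 𝒮.S) (σ' : Lifting G 𝒮.S') :
    (∀ ψ : ParMonoidalComonad 𝒮.toLDNeg.toLinearlyDistributive G,
      IsLDComonad 𝒮.toLDNeg G φ ψ σ σ' → IsStarComonad 𝒮 G φ σ σ') ∧
    (IsStarComonad 𝒮 G φ σ σ' →
      ∃! ψ : ParMonoidalComonad 𝒮.toLDNeg.toLinearlyDistributive G,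
        IsLDComonad 𝒮.toLDNeg G φ ψ σ σ') := by
  refine ⟨fun ψ h => (StarComonad.LDLifts.of_isLDComonad h).starLifts.isStarComonad, fun h => ?_⟩
  have h' := StarComonad.StarLifts.of_isStarComonad 𝒮 h
  exact ⟨h'.parMonoidalComonad, h'.ldLifts.isLDComonad,
    fun ψ hψ => (StarComonad.LDLifts.of_isLDComonad hψ).unique h'.ldLifts⟩
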